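/- Let $\ell,L>0$, let $Q_1=[0,\ell]\times[0,1]$ and $Q_2=[0,L]\times[0,1]$ be rectangles in $\mathbb C$ ($z=x+iy$), let $\lambda:(0,\ell)\to(0,\infty)$ be a measurable positive weight, and let $\varphi:[1,\infty)\to[0,\infty)$ be convex and increasing (not necessarily strictly). A map $f$ has finite distortion on the open rectangle $(0,\ell)\times(0,1)$ if it is of Sobolev class $W^{1,1}_{loc}$ there, its Jacobian $J(z,f)=\mathrm{Im}(\overline{f_x}f_y)$ is nonnegative a.e., and $|Df|^2:=|f_x|^2+|f_y|^2\le K(z)\,J(z,f)$ a.e. for some finite function $K$. Its distortion function is $$\mathbb K(z,f)=\frac{|f_x|^2+|f_y|^2}{J(z,f)}\quad\text{where } J(z,f)>0,$$ and $\mathbb K(z,f)=2$ (the value for conformal maps, which is the least value of the quotient) where $J(z,f)=0$. Let $u:[0,\ell]\to[0,L]$ be absolutely continuous with $u_x>0$ a.e., with $$u(0)=0,\qquad u(\ell)=L_0\le L,$$ and suppose that for some constant $\alpha\neq0$ $$\lambda(x)\Big(1-\frac1{u_x(x)^2}\Big)\varphi'\Big(u_x(x)+\frac1{u_x(x)}\Big)=\alpha\qquad\text{for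 a.e. }x\in(0,\ell)$$ (in particular $\varphi$ is differentiable at $u_x(x)+1/u_x(x)$ for a.e. $x$). If $\alpha<0$, assume moreover that $L_0=L$. Put $f_0(x+iy)=u(x)+iy$ on $Q_1$. Let $f:Q_1\to Q_2$ be a surjective homeomorphism of finite distortion with $$\mathrm{Re} f(0,y)=0,\quad \mathrm{Re} f(\ell,y)=L,\quad \mathrm{Im} f(x,0)=0,\quad \mathrm{Im} f(x,1)=1$$ for all $x\in[0,\ell]$, $y\in[0,1]$. Then, in $[0,\infty]$, $$\int_{Q_1}\varphi(\mathbb K(z,f))\,\lambda(x)\,|dz|^2\;\ge\;\int_{Q_1}\varphi(\mathbb K(z,f_0))\,\lambda(x)\,|dz|^2 .$$ If the right-hand side is finite, then equality holds if and only if $f=f_0$ on $Q_1$, and in particular the inequality is strict if $L_0<L$. -/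

import Mathlib

open MeasureTheory Set
open scoped ContDiff ENNReal

noncomputable section

/-- The closed rectangle `[0, a] × [0, 1]` in `ℂ`. -/
def closedRect (a : ℝ) : Set ℂ := {z | z.re ∈ Icc 0 a ∧ z.im ∈ Icc 0 1}

/-- The open rectangle `(0, a) × (0, 1)` in `ℂ`. -/
def openRect (a : ℝ) : Set ℂ := {z | z.re ∈ Ioo 0 a ∧ z.im ∈ Ioo 0 1}

/-- `g` is a weak (distributional) derivative of `f` on the open set `U` in the direction `v`,
both functions being locally integrable on `U`. -/
def IsWeakPartial (U : Set ℂ) (v : ℂ) (f g : ℂ → ℂ) : Prop :=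
  LocallyIntegrableOn f U ∧ LocallyIntegrableOn g U ∧
    ∀ η : ℂ → ℝ, ContDiff ℝ ∞ η → HasCompactSupport η → tsupport η ⊆ U →
      ∫ z in U, (fderiv ℝ η z v) • f z = -∫ z in U, η z • g z

open Classical in
/-- The weak derivative of `f` on `U` in the direction `v` (a representative of it; it is unique
up to null sets in `U`). It is `0` by default if there is no weak derivative. -/
def weakPartial (U : Set ℂ) (v : ℂ) (f : ℂ → ℂ) : ℂ → ℂ :=
  if h : ∃ g, IsWeakPartial U v f g then h.choose else 0

/-- The Sobolev class `W^{1,1}_loc(U)`. -/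
def SobolevOneOneLoc (U : Set ℂ) (f : ℂ → ℂ) : Prop :=
  (∃ g, IsWeakPartial U 1 f g) ∧ (∃ g, IsWeakPartial U Complex.I f g)

/-- `|Df|² = |f_x|² + |f_y|²`. -/
def normSqDeriv (U : Set ℂ) (f : ℂ → ℂ) (z : ℂ) : ℝ :=
  ‖weakPartial U 1 f z‖ ^ 2 + ‖weakPartial U Complex.I f z‖ ^ 2

/-- The Jacobian determinant of `f = R + i S`, namely `R_x S_y - S_x R_y`. -/
def jacobian (U : Set ℂ) (f : ℂ → ℂ) (z : ℂ) : ℝ :=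
  (weakPartial U 1 f z).re * (weakPartial U Complex.I f z).im -
    (weakPartial U 1 f z).im * (weakPartial U Complex.I f z).re

/-- `f` restricts to a homeomorphism of `A` onto `B`. -/
def IsHomeoOnto (f : ℂ → ℂ) (A B : Set ℂ) : Prop :=
  ∃ h : A ≃ₜ B, ∀ z : A, (h z : ℂ) = f z

/-- `f` has finite distortion on `U`: it is of class `W^{1,1}_loc`, its Jacobian is nonnegative
almost everywhere, and `|Df|² ≤ K J` almost everywhere for some finite function `K`. -/
def HasFiniteDistortion (U : Set ℂ) (f : ℂ → ℂ) : Prop :=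
  SobolevOneOneLoc U f ∧
    (∀ᵐ z ∂volume.restrict U, 0 ≤ jacobian U f z) ∧
    ∃ K : ℂ → ℝ, ∀ᵐ z ∂volume.restrict U, normSqDeriv U f z ≤ K z * jacobian U f z

open Classical in
/-- The distortion function `𝕂(z, f) = (|f_x|² + |f_y|²) / J(z, f)`. Where the Jacobian vanishes
(and hence, for a map of finite distortion, almost everywhere also the differential) it takes, by
the usual convention, the value of a conformal map, which is `2` in this normalisation and is the
least value of the quotient. -/
def distortion (U : Set ℂ) (f : ℂ → ℂ) (z : ℂ) : ℝ :=
  if 0 < jacobian U f z then normSqDeriv U f z / jacobian U f z else 2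

/-- The functional `f ↦ ∫ φ(𝕂(z, f)) w(x) |dz|²` over `(0, ℓ) × (0, 1)`, with values in
`[0, ∞]`. -/
def distortionEnergy (ℓ : ℝ) (φ w : ℝ → ℝ) (f : ℂ → ℂ) : ℝ≥0∞ :=
  ∫⁻ z in openRect ℓ, ENNReal.ofReal (φ (distortion (openRect ℓ) f z) * w z.re)

/-- The boundary conditions of the Grötzsch problem from `[0, ℓ] × [0, 1]` to
`[0, L] × [0, 1]`. -/
def GrotzschBoundary (ℓ L : ℝ) (f : ℂ → ℂ) : Prop :=
  (∀ y ∈ Icc (0 : ℝ) 1, (f ⟨0, y⟩).re = 0 ∧ (f ⟨ℓ, y⟩).re = L) ∧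
    (∀ x ∈ Icc (0 : ℝ) ℓ, (f ⟨x, 0⟩).im = 0 ∧ (f ⟨x, 1⟩).im = 1)

/-- The map `x + i y ↦ u(x) + i y`. -/
def stretchMap (u : ℝ → ℝ) (z : ℂ) : ℂ := ⟨u z.re, z.im⟩

/-- `u` is an (absolutely continuous, almost everywhere) solution on `[0, ℓ]` of
`w(x) (1 - 1 / u_x²) φ'(u_x + 1 / u_x) = α` with `u_x > 0`. For `α ≠ 0` the equation forces `φ`
to be differentiable at `u_x + 1 / u_x`, since otherwise `deriv φ` is `0` there. -/
def IsODESolution (ℓ : ℝ) (φ w : ℝ → ℝ) (α : ℝ) (u : ℝ → ℝ) : Prop :=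
  AbsolutelyContinuousOnInterval u 0 ℓ ∧
    ∀ᵐ x ∂volume.restrict (Ioo 0 ℓ), 0 < deriv u x ∧
      w x * (1 - 1 / deriv u x ^ 2) * deriv φ (deriv u x + 1 / deriv u x) = α

end

/-!
Write `f = R + i S`, `J` for the Jacobian of `f`, `λ` for the weight, and `p = u_x`. The proof
compares the energy densities of `f` and of the stretch map `f₀` pointwise, and then integrates the
comparison by the length-area method.

By convexity, `φ(𝕂) ≥ φ(p + 1/p) + φ'(p + 1/p) (𝕂 - p - 1/p)`, and the differential equation says
that `λ φ'(p + 1/p)` is `α / (1 - 1/p²)`. Let `A = |f_x|² / J` and `B = |f_y|² / J`, so that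
`𝕂 = A + B` and `A B ≥ 1`. If `α > 0`, then `p > 1`, and `A + 1/A` lies above its tangent at `p`, which
together with `A ≥ 2 R_x - J` gives

  `φ(𝕂) λ + α (J + p) ≥ φ(p + 1/p) λ + 2 α R_x⁺`.

If `α < 0`, then `p < 1`, and the tangent of `B + 1/B` at `1/p` and `p² B ≥ 2 p S_y - J` give the
same inequality with `|α|` and `p S_y⁺` in place of `α` and `R_x⁺` (`energyDensity_pointwise`).
All terms are nonnegative, so that the inequality may be integrated without any integrability of
the energies. Where `J = 0`, finite distortion gives `Df = 0`, and `𝕂 = 2` makes the inequality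
strict. After integration, `∫ p = L₀` and `∫ J ≤ L`, the area of the image, and `∫ R_x⁺ ≥ L`,
respectively `∫ p S_y⁺ ≥ ∫ p = L₀ = L`, because of the boundary values. Hence the energy of `f`
exceeds that of the stretch map by at least `|α| (L - L₀)`. In the case of equality the pointwise
inequality is an equality almost everywhere, which forces `Df = Df₀`, and the boundary values then
give `f = f₀`.

Two facts about the Sobolev homeomorphism `f` carry the integration.

* Absolute continuity on lines (`HasWeakDerivFst.ae_sub_eq_integral`): on almost every line
  parallel to an axis, `f` is a primitive of its weak derivative. Testing with products
  `a(x) b(y)` reduces this to one dimension, where the smooth steps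
  `Real.smoothTransition ((x - r) / ε)` approximate the indicator functions of intervals.
* The area inequality (`lintegral_abs_jacobian_le`): almost every point has partial derivatives,
  and by Egorov's theorem the difference quotients converge uniformly on sets `E` of almost full
  measure. The restriction of `f` to such a set is differentiable
  (`hasFDerivWithinAt_of_uniform`), and the change of variables formula for injective maps applies
  to it.
-/

open Filter Topology

/-! ### Weak derivatives on an interval -/

lemma Real.contDiff_smoothTransition_div (r ε : ℝ) :
    ContDiff ℝ ∞ (fun x : ℝ => Real.smoothTransition ((x - r) / ε)) :=
  Real.smoothTransition.contDiff.comp ((contDiff_id.sub contDiff_const).div_const _)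

lemma Real.deriv_smoothTransition_div (r ε x : ℝ) :
    deriv (fun x : ℝ => Real.smoothTransition ((x - r) / ε)) x
      = ε⁻¹ * deriv Real.smoothTransition ((x - r) / ε) := by
  have h1 : HasDerivAt Real.smoothTransition (deriv Real.smoothTransition ((x - r) / ε))
      ((x - r) / ε) :=
    ((Real.smoothTransition.contDiff (n := 1)).differentiable (by simp)).differentiableAt.hasDerivAt
  have h2 : HasDerivAt (fun x : ℝ => (x - r) / ε) (1 / ε) x :=
    ((hasDerivAt_id x).sub_const r).div_const ε
  refine (h1.comp x h2).deriv.trans ?_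
  rw [one_div, mul_comm]

lemma Real.deriv_smoothTransition_of_notMem {x : ℝ} (hx : x ∉ Icc (0 : ℝ) 1) :
    deriv Real.smoothTransition x = 0 := by
  rcases not_and_or.1 hx with h | h
  · have : Real.smoothTransition =ᶠ[𝓝 x] fun _ => 0 := by
      filter_upwards [eventually_lt_nhds (not_le.1 h)] with y hy
        using Real.smoothTransition.zero_of_nonpos hy.le
    simpa using this.deriv_eq
  · have : Real.smoothTransition =ᶠ[𝓝 x] fun _ => 1 := by
      filter_upwards [eventually_gt_nhds (not_le.1 h)] with y hy
        using Real.smoothTransition.one_of_one_le hy.le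
    simpa using this.deriv_eq

/-- The derivatives of the smooth steps at `r` converge to the Dirac mass at `r`. -/
lemma tendsto_integral_deriv_smoothTransition_div {c : ℝ → ℂ} (hc : Continuous c) {r A : ℝ}
    (h0 : 0 < r) (hA : r < A) :
    Tendsto (fun ε => ∫ x in Ioo 0 A,
      deriv (fun x : ℝ => Real.smoothTransition ((x - r) / ε)) x • c x) (𝓝[>] 0) (𝓝 (c r)) := by
  have hd : Continuous (deriv Real.smoothTransition) :=
    (Real.smoothTransition.contDiff (n := 1)).continuous_deriv le_rfl
  have h1 : Continuous fun ε : ℝ =>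
      ∫ t in (0:ℝ)..1, deriv Real.smoothTransition t • c (r + ε * t) := by
    apply intervalIntegral.continuous_parametric_intervalIntegral_of_continuous'
    simp only [Function.uncurry_def]
    fun_prop
  have h2 : ∫ t in (0:ℝ)..1, deriv Real.smoothTransition t • c (r + 0 * t) = c r := by
    simp only [zero_mul, add_zero]
    rw [intervalIntegral.integral_smul_const, intervalIntegral.integral_deriv_eq_sub]
    · simp
    · exact fun x _ =>
        ((Real.smoothTransition.contDiff (n := 1)).differentiable (by simp)).differentiableAt
    · exact hd.intervalIntegrable _ _
  have h3 := (h1.tendsto 0).mono_left (nhdsWithin_le_nhds (s := Ioi 0))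
  rw [h2] at h3
  refine h3.congr' ?_
  have hev : ∀ᶠ ε : ℝ in 𝓝[>] 0, ε < A - r :=
    (eventually_lt_nhds (by linarith)).filter_mono nhdsWithin_le_nhds
  filter_upwards [hev, self_mem_nhdsWithin] with ε hε hpos
  have hpos : 0 < ε := hpos
  simp only [Real.deriv_smoothTransition_div]
  have h4 := intervalIntegral.smul_integral_comp_add_mul (a := 0) (b := 1)
    (fun x => (ε⁻¹ * deriv Real.smoothTransition ((x - r) / ε)) • c x) ε r
  have h5 : ∀ t : ℝ, (ε⁻¹ * deriv Real.smoothTransition ((r + ε * t - r) / ε)) • c (r + ε * t)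
      = ε⁻¹ • deriv Real.smoothTransition t • c (r + ε * t) := by
    intro t
    rw [add_sub_cancel_left, mul_div_cancel_left₀ _ hpos.ne', mul_smul]
  simp only [h5, intervalIntegral.integral_smul, smul_inv_smul₀ hpos.ne'] at h4
  rw [h4, intervalIntegral.integral_of_le (by nlinarith), mul_zero, add_zero, mul_one]
  refine (setIntegral_eq_of_subset_of_forall_sdiff_eq_zero measurableSet_Ioo ?_ ?_).symm
  · intro x hx
    exact ⟨h0.trans hx.1, by linarith [hx.2]⟩
  · intro x hx
    by_cases hxr : x = r
    · subst hxr
      have : deriv Real.smoothTransition 0 = 0 := by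
        have hmin : IsLocalMin Real.smoothTransition 0 :=
          Eventually.of_forall fun y => by
            rw [Real.smoothTransition.zero]; exact Real.smoothTransition.nonneg y
        exact hmin.deriv_eq_zero
      simp [this]
    rw [Real.deriv_smoothTransition_of_notMem, mul_zero, zero_smul]
    intro h
    apply hx.2
    have h6 := h.1
    have h7 := h.2
    rw [div_le_one hpos] at h7
    have h8 : 0 ≤ x - r := by
      by_contra! hh
      exact absurd h6 (not_le.2 (div_neg_of_neg_of_pos hh hpos))
    exact ⟨lt_of_le_of_ne (by linarith) (Ne.symm hxr), by linarith⟩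

/-- A continuous function on an interval is the primitive of its weak derivative. -/
lemma sub_eq_integral_of_weakDeriv {A : ℝ} {c d : ℝ → ℂ} (hc : Continuous c)
    (hd : ∀ r s, 0 < r → s < A → IntegrableOn d (Icc r s))
    (H : ∀ a : ℝ → ℝ, ContDiff ℝ ∞ a → HasCompactSupport a → tsupport a ⊆ Ioo 0 A →
      ∫ x in Ioo 0 A, deriv a x • c x = -∫ x in Ioo 0 A, a x • d x)
    {r s : ℝ} (hr : 0 < r) (hrs : r ≤ s) (hs : s < A) :
    c s - c r = ∫ x in r..s, d x := by
  set T : ℝ → ℝ → ℝ → ℝ := fun r ε x => Real.smoothTransition ((x - r) / ε) with hT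
  set s' := (s + A) / 2 with hs'
  have hss' : s < s' := by linarith
  have hs'A : s' < A := by linarith
  have T0 : ∀ {r ε x}, 0 < ε → x ≤ r → T r ε x = 0 := fun hε hx =>
    Real.smoothTransition.zero_of_nonpos (div_nonpos_of_nonpos_of_nonneg (by linarith) hε.le)
  have T1 : ∀ {r ε x}, 0 < ε → r + ε ≤ x → T r ε x = 1 := fun hε hx =>
    Real.smoothTransition.one_of_one_le ((one_le_div hε).2 (by linarith))
  have hTd : ∀ r ε, Differentiable ℝ (T r ε) := fun r ε =>
    (Real.contDiff_smoothTransition_div r ε).differentiable (by simp)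
  have hTdc : ∀ r ε, Continuous (deriv (T r ε)) := fun r ε =>
    (Real.contDiff_smoothTransition_div r ε).continuous_deriv (by simp)
  have hev : ∀ᶠ ε : ℝ in 𝓝[>] 0, ε < s' - s :=
    (eventually_lt_nhds (by linarith)).filter_mono nhdsWithin_le_nhds
  have key : ∀ᶠ ε : ℝ in 𝓝[>] 0,
      (∫ x in Ioo 0 A, deriv (T r ε) x • c x) - ∫ x in Ioo 0 A, deriv (T s ε) x • c x
        = -∫ x in Icc r s', (T r ε x - T s ε x) • d x := by
    filter_upwards [hev, self_mem_nhdsWithin] with ε hε hpos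
    have hpos : 0 < ε := hpos
    have hzero : ∀ x, x ∉ Icc r s' → T r ε x - T s ε x = 0 := by
      intro x hx
      rcases not_and_or.1 hx with h | h
      · rw [T0 hpos (by linarith), T0 hpos (by linarith), sub_zero]
      · rw [T1 hpos (by linarith), T1 hpos (by linarith), sub_self]
    have hsupp : tsupport (fun x => T r ε x - T s ε x) ⊆ Icc r s' :=
      closure_minimal (fun x hx => by_contra fun h => hx (hzero x h)) isClosed_Icc
    have hsub : Icc r s' ⊆ Ioo 0 A := fun x hx => ⟨hr.trans_le hx.1, hx.2.trans_lt hs'A⟩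
    have := H (fun x => T r ε x - T s ε x)
      ((Real.contDiff_smoothTransition_div r ε).sub (Real.contDiff_smoothTransition_div s ε))
      (HasCompactSupport.of_support_subset_isCompact isCompact_Icc
        ((subset_tsupport _).trans hsupp)) (hsupp.trans hsub)
    rw [setIntegral_eq_of_subset_of_forall_sdiff_eq_zero measurableSet_Ioo hsub
      (f := fun x => (T r ε x - T s ε x) • d x)
      (fun x hx => by simp only [hzero x hx.2, zero_smul])] at this
    rw [← this, ← integral_sub]
    · refine integral_congr_ae (Eventually.of_forall fun x => ?_)
      have : deriv (fun x => T r ε x - T s ε x) x = deriv (T r ε) x - deriv (T s ε) x :=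
        ((hTd r ε x).hasDerivAt.sub (hTd s ε x).hasDerivAt).deriv
      simp only [this, sub_smul]
    · exact (((hTdc r ε).smul hc).integrableOn_Icc (a := 0) (b := A)).mono_set Ioo_subset_Icc_self
    · exact (((hTdc s ε).smul hc).integrableOn_Icc (a := 0) (b := A)).mono_set Ioo_subset_Icc_self
  have lim1 := (tendsto_integral_deriv_smoothTransition_div hc hr (hrs.trans_lt hs)).sub
    (tendsto_integral_deriv_smoothTransition_div hc (hr.trans_le hrs) hs)
  have lim2 : Tendsto (fun ε => ∫ x in Icc r s', (T r ε x - T s ε x) • d x) (𝓝[>] 0)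
      (𝓝 (∫ x in Icc r s', (Ioc r s).indicator d x)) := by
    refine tendsto_integral_filter_of_dominated_convergence (fun x => 2 * ‖d x‖) ?_ ?_ ?_ ?_
    · refine Eventually.of_forall fun ε => ?_
      exact (((hTd r ε).continuous.sub (hTd s ε).continuous).aestronglyMeasurable).smul
        (hd r s' hr hs'A).aestronglyMeasurable
    · refine Eventually.of_forall fun ε => Eventually.of_forall fun x => ?_
      rw [norm_smul]
      refine mul_le_mul_of_nonneg_right ?_ (norm_nonneg _)
      have a1 := Real.smoothTransition.nonneg ((x - r) / ε)
      have a2 := Real.smoothTransition.le_one ((x - r) / ε)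
      have a3 := Real.smoothTransition.nonneg ((x - s) / ε)
      have a4 := Real.smoothTransition.le_one ((x - s) / ε)
      rw [Real.norm_eq_abs, abs_le]
      constructor <;> simp only [hT] <;> linarith
    · exact ((hd r s' hr hs'A).norm).const_mul 2
    · refine Eventually.of_forall fun x => ?_
      have step : ∀ r : ℝ, ∀ᶠ ε : ℝ in 𝓝[>] 0, T r ε x = if r < x then 1 else 0 := by
        intro r
        split_ifs with h
        · have : ∀ᶠ ε : ℝ in 𝓝[>] 0, ε < x - r :=
            (eventually_lt_nhds (by linarith)).filter_mono nhdsWithin_le_nhds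
          filter_upwards [this, self_mem_nhdsWithin] with ε hε hpos
          exact T1 hpos (by linarith)
        · filter_upwards [self_mem_nhdsWithin] with ε hpos
          exact T0 hpos (not_lt.1 h)
      refine tendsto_const_nhds.congr' ?_
      filter_upwards [step r, step s] with ε h1 h2
      rw [h1, h2]
      by_cases hx1 : r < x <;> by_cases hx2 : s < x
      · simp [hx1, hx2]
      · simp [hx1, hx2, not_lt.1 hx2]
      · exact absurd (hrs.trans_lt hx2) hx1
      · simp [hx1, hx2]
  have := tendsto_nhds_unique (lim1.congr' key) lim2.neg
  rw [integral_indicator measurableSet_Ioc, Measure.restrict_restrict measurableSet_Ioc,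
    inter_eq_self_of_subset_left
      (show Ioc r s ⊆ Icc r s' from fun x hx => ⟨hx.1.le, hx.2.trans hss'.le⟩),
    ← intervalIntegral.integral_of_le hrs] at this
  rw [← neg_sub, this, neg_neg]

/-! ### Weak derivatives on a rectangle, and absolute continuity on lines -/

lemma IsCompact.exists_subset_Icc_of_subset_Ioo {K : Set ℝ} (hK : IsCompact K) {a b : ℝ}
    (h : K ⊆ Ioo a b) : ∃ r s, a < r ∧ s < b ∧ K ⊆ Icc r s := by
  rcases K.eq_empty_or_nonempty with rfl | hne
  · exact ⟨a + 1, b - 1, by linarith, by linarith, empty_subset _⟩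
  obtain ⟨r, hr⟩ := hK.exists_isLeast hne
  obtain ⟨s, hs⟩ := hK.exists_isGreatest hne
  exact ⟨r, s, (h hr.1).1, (h hs.1).2, fun x hx => ⟨hr.2 hx, hs.2 hx⟩⟩

lemma MeasureTheory.Integrable.of_integrable_Icc_prod {φ : ℝ × ℝ → ℂ} {r s r' s' : ℝ}
    (h : Integrable φ ((volume.restrict (Icc r s)).prod (volume.restrict (Icc r' s'))))
    (h0 : ∀ p, p ∉ Icc r s ×ˢ Icc r' s' → φ p = 0) (S T : Set ℝ) :
    Integrable φ ((volume.restrict S).prod (volume.restrict T)) := by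
  rw [Measure.prod_restrict] at h ⊢
  exact ((integrableOn_iff_integrable_of_support_subset
    (fun p hp => by_contra fun hn => hp (h0 p hn))).1 h).restrict

/-- `G` is the weak derivative of the continuous function `F` on `(0, A) × (0, B)` with respect to
the first variable, where only products `a(x) b(y)` are used as test functions and local
integrability is spelled out on compact rectangles. -/
structure HasWeakDerivFst (A B : ℝ) (F G : ℝ × ℝ → ℂ) : Prop where
  continuous : Continuous F
  integrable : ∀ r s r' s' : ℝ, 0 < r → s < A → 0 < r' → s' < B →
    Integrable G ((volume.restrict (Icc r s)).prod (volume.restrict (Icc r' s')))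
  integral_eq : ∀ a b : ℝ → ℝ, ContDiff ℝ ∞ a → HasCompactSupport a → tsupport a ⊆ Ioo 0 A →
    ContDiff ℝ ∞ b → HasCompactSupport b → tsupport b ⊆ Ioo 0 B →
    ∫ p, (deriv a p.1 * b p.2) • F p
        ∂((volume.restrict (Ioo 0 A)).prod (volume.restrict (Ioo 0 B)))
      = -∫ p, (a p.1 * b p.2) • G p
        ∂((volume.restrict (Ioo 0 A)).prod (volume.restrict (Ioo 0 B)))

namespace HasWeakDerivFst

variable {A B : ℝ} {F G : ℝ × ℝ → ℂ}

lemma ae_sub_eq_integral_fixed (h : HasWeakDerivFst A B F G) {r s : ℝ} (hr : 0 < r)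
    (hrs : r ≤ s) (hs : s < A) :
    ∀ᵐ y, y ∈ Ioo 0 B → F (s, y) - F (r, y) - ∫ x in Icc r s, G (x, y) = 0 := by
  have hFc := h.continuous
  have hF1 : ∀ x, Continuous fun y => F (x, y) := fun x => by fun_prop
  refine isOpen_Ioo.ae_eq_zero_of_integral_contDiff_smul_eq_zero ?_ ?_
  · refine LocallyIntegrableOn.sub
      (((hF1 s).sub (hF1 r)).locallyIntegrable.locallyIntegrableOn _) ?_
    rw [locallyIntegrableOn_iff isOpen_Ioo.isLocallyClosed]
    intro K hK hKc
    obtain ⟨r', s', h1, h2, h3⟩ := hKc.exists_subset_Icc_of_subset_Ioo hK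
    exact (h.integrable r s r' s' hr hs h1 h2).integral_prod_right.mono_measure
      (Measure.restrict_mono h3 le_rfl)
  · intro b hb hbc hbs
    obtain ⟨r', s', hr', hs', hsub⟩ := hbc.isCompact.exists_subset_Icc_of_subset_Ioo hbs
    have hb0 : ∀ y, y ∉ Icc r' s' → b y = 0 := fun y hy =>
      image_eq_zero_of_notMem_tsupport fun h => hy (hsub h)
    have hIoo : Icc r' s' ⊆ Ioo 0 B := fun y hy => ⟨hr'.trans_le hy.1, hy.2.trans_lt hs'⟩
    have hIcc : ∀ k : ℝ → ℂ, ∫ y in Ioo 0 B, b y • k y = ∫ y in Icc r' s', b y • k y := fun k =>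
      setIntegral_eq_of_subset_of_forall_sdiff_eq_zero measurableSet_Ioo hIoo
        fun y hy => by rw [hb0 y hy.2, zero_smul]
    have hbG : ∀ r s, 0 < r → s < A → Integrable (fun p : ℝ × ℝ => b p.2 • G p)
        ((volume.restrict (Icc r s)).prod (volume.restrict (Icc r' s'))) := by
      intro r s hr hs
      obtain ⟨C, hC⟩ := hbc.exists_bound_of_continuous hb.continuous
      exact (h.integrable r s r' s' hr hs hr' hs').bdd_smul C
        ((hb.continuous.comp continuous_snd).aestronglyMeasurable)
        (Eventually.of_forall fun p => hC p.2)
    have hFb : Continuous fun p : ℝ × ℝ => b p.2 • F p :=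
      (hb.continuous.comp continuous_snd).smul hFc
    -- Integrating against `b` in the second variable reduces the claim to one dimension.
    have h1 := sub_eq_integral_of_weakDeriv (A := A) (r := r) (s := s)
      (c := fun x => ∫ y in Icc r' s', b y • F (x, y))
      (d := fun x => ∫ y in Icc r' s', b y • G (x, y)) ?_ ?_ ?_ hr hrs hs
    · have e1 : ∫ y, b y • (F (s, y) - F (r, y) - ∫ x in Icc r s, G (x, y))
          = ∫ y in Icc r' s', b y • (F (s, y) - F (r, y) - ∫ x in Icc r s, G (x, y)) := by
        rw [setIntegral_eq_integral_of_forall_compl_eq_zero]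
        intro y hy
        rw [hb0 y hy, zero_smul]
      have i1 : ∀ x, Integrable (fun y => b y • F (x, y)) (volume.restrict (Icc r' s')) :=
        fun x => (hb.continuous.smul (hF1 x)).integrableOn_Icc
      have i2 := (hbG r s hr hs).integral_prod_right
      rw [e1]
      simp only [smul_sub]
      have e2 : ∀ y, b y • ∫ x in Icc r s, G (x, y) = ∫ x in Icc r s, b y • G (x, y) :=
        fun y => (integral_smul _ _).symm
      simp only [e2]
      rw [integral_sub (f := fun y => b y • F (s, y) - b y • F (r, y)) ((i1 s).sub (i1 r)) i2,
        integral_sub (i1 s) (i1 r), h1,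
        intervalIntegral.integral_of_le hrs, ← integral_Icc_eq_integral_Ioc,
        integral_integral_swap (f := fun x y => b y • G (x, y)) (hbG r s hr hs), sub_self]
    · exact continuous_parametric_integral_of_continuous (f := fun x y => b y • F (x, y)) hFb
        isCompact_Icc
    · exact fun r s hr hs => (hbG r s hr hs).integral_prod_left
    · intro a ha hac has
      obtain ⟨ρ, σ, hρ, hσ, hsub'⟩ := hac.isCompact.exists_subset_Icc_of_subset_Ioo has
      have ha0 : ∀ x, x ∉ Icc ρ σ → a x = 0 := fun x hx =>
        image_eq_zero_of_notMem_tsupport fun h => hx (hsub' h)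
      have hda0 : ∀ x, x ∉ Icc ρ σ → deriv a x = 0 := fun x hx =>
        image_eq_zero_of_notMem_tsupport fun h => hx (hsub' (tsupport_deriv_subset h))
      have hda : Continuous (deriv a) := ha.continuous_deriv (by simp)
      have := h.integral_eq a b ha hac has hb hbc hbs
      rw [integral_prod, integral_prod] at this
      · simp only [← hIcc, ← integral_smul, smul_smul]
        exact this
      · refine Integrable.of_integrable_Icc_prod (r := ρ) (s := σ) (r' := r') (s' := s') ?_ ?_ _ _
        · obtain ⟨C, hC⟩ := hac.exists_bound_of_continuous ha.continuous
          have : Integrable (fun p : ℝ × ℝ => a p.1 • b p.2 • G p) ((volume.restrict (Icc ρ σ)).prod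
              (volume.restrict (Icc r' s'))) := (hbG ρ σ hρ hσ).bdd_smul C
            ((ha.continuous.comp continuous_fst).aestronglyMeasurable)
            (Eventually.of_forall fun p => hC p.1)
          exact this.congr (Eventually.of_forall fun p => smul_smul _ _ _)
        · intro p hp
          rcases not_and_or.1 hp with h | h
          · rw [ha0 _ h, zero_mul, zero_smul]
          · rw [hb0 _ h, mul_zero, zero_smul]
      · refine Integrable.of_integrable_Icc_prod (r := ρ) (s := σ) (r' := r') (s' := s') ?_ ?_ _ _
        · rw [Measure.prod_restrict]
          exact (((hda.comp continuous_fst).mul (hb.continuous.comp continuous_snd)).smul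
            hFc).continuousOn.integrableOn_compact (isCompact_Icc.prod isCompact_Icc)
        · intro p hp
          rcases not_and_or.1 hp with h | h
          · rw [hda0 _ h, zero_mul, zero_smul]
          · rw [hb0 _ h, mul_zero, zero_smul]

/-- Absolute continuity on lines: on almost every horizontal line, `F` is the primitive of its weak
derivative. -/
lemma ae_sub_eq_integral (h : HasWeakDerivFst A B F G) :
    ∀ᵐ y ∂volume.restrict (Ioo 0 B), ∀ r s, 0 < r → r ≤ s → s < A →
      IntervalIntegrable (fun x => G (x, y)) volume r s ∧
        F (s, y) - F (r, y) = ∫ x in r..s, G (x, y) := by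
  have hint : ∀ᵐ y, ∀ q : ℚ × ℚ × ℚ × ℚ, 0 < (q.1 : ℝ) → (q.2.1 : ℝ) < A → 0 < (q.2.2.1 : ℝ) →
      (q.2.2.2 : ℝ) < B → y ∈ Icc (q.2.2.1 : ℝ) q.2.2.2 →
      IntegrableOn (fun x => G (x, y)) (Icc (q.1 : ℝ) q.2.1) := by
    rw [ae_all_iff]
    intro q
    by_cases hq : 0 < (q.1 : ℝ) ∧ (q.2.1 : ℝ) < A ∧ 0 < (q.2.2.1 : ℝ) ∧ (q.2.2.2 : ℝ) < B
    · have := (h.integrable _ _ _ _ hq.1 hq.2.1 hq.2.2.1 hq.2.2.2).prod_left_ae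
      rw [ae_restrict_iff' measurableSet_Icc] at this
      filter_upwards [this] with y hy _ _ _ _ using hy
    · exact Eventually.of_forall fun y h1 h2 h3 h4 => absurd ⟨h1, h2, h3, h4⟩ hq
  have heq : ∀ᵐ y, ∀ q : ℚ × ℚ, 0 < (q.1 : ℝ) → (q.1 : ℝ) ≤ q.2 → (q.2 : ℝ) < A → y ∈ Ioo 0 B →
      F (q.2, y) - F (q.1, y) - ∫ x in Icc (q.1 : ℝ) q.2, G (x, y) = 0 := by
    rw [ae_all_iff]
    intro q
    by_cases hq : 0 < (q.1 : ℝ) ∧ (q.1 : ℝ) ≤ q.2 ∧ (q.2 : ℝ) < A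
    · filter_upwards [h.ae_sub_eq_integral_fixed hq.1 hq.2.1 hq.2.2] with y hy _ _ _ using hy
    · exact Eventually.of_forall fun y h1 h2 h3 => absurd ⟨h1, h2, h3⟩ hq
  rw [ae_restrict_iff' measurableSet_Ioo]
  filter_upwards [hint, heq] with y h1 h2 hy
  obtain ⟨r', hr'0, hr'⟩ := exists_rat_btwn hy.1
  obtain ⟨s', hs', hs'B⟩ := exists_rat_btwn hy.2
  have hI : ∀ r s, 0 < r → s < A → IntegrableOn (fun x => G (x, y)) (Icc r s) := by
    intro r s hr hs
    obtain ⟨ρ, hρ0, hρ⟩ := exists_rat_btwn hr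
    obtain ⟨σ, hσ, hσA⟩ := exists_rat_btwn hs
    exact (h1 (ρ, σ, r', s') hρ0 hσA hr'0 hs'B ⟨hr'.le, hs'.le⟩).mono_set
      (Icc_subset_Icc hρ.le hσ.le)
  have hII : ∀ r s, 0 < r → r ≤ s → s < A → IntervalIntegrable (fun x => G (x, y)) volume r s :=
    fun r s hr hrs hs => (intervalIntegrable_iff_integrableOn_Icc_of_le hrs).2 (hI r s hr hs)
  refine fun r s hr hrs hs => ⟨hII r s hr hrs hs, ?_⟩
  have hFy : Continuous fun x => F (x, y) := by have := h.continuous; fun_prop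
  obtain ⟨ρ, hρ0, hρ⟩ := exists_rat_btwn hr
  obtain ⟨σ, hσ, hσA⟩ := exists_rat_btwn hs
  -- The identity with a rational left end extends from rational to real right ends by continuity.
  have key : EqOn (fun t => F (t, y) - F (ρ, y)) (fun t => ∫ x in (ρ : ℝ)..t, G (x, y))
      (Icc (ρ : ℝ) σ) := by
    refine EqOn.of_subset_closure (s := Ioo (ρ : ℝ) σ ∩ range ((↑) : ℚ → ℝ)) ?_
      (hFy.sub continuous_const).continuousOn ?_ ?_ ?_
    · rintro _ ⟨ht, t, rfl⟩
      have := h2 (ρ, t) hρ0 ht.1.le (ht.2.trans hσA) hy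
      simp only
      rw [intervalIntegral.integral_of_le ht.1.le, ← integral_Icc_eq_integral_Ioc]
      exact sub_eq_zero.1 this
    · have := intervalIntegral.continuousOn_primitive_interval (μ := volume)
        (f := fun x => G (x, y)) (a := (ρ : ℝ)) (b := σ) (by
          rw [uIcc_of_le (hρ.le.trans (hrs.trans hσ.le))]
          exact hI _ _ hρ0 hσA)
      rwa [uIcc_of_le (hρ.le.trans (hrs.trans hσ.le))] at this
    · exact inter_subset_left.trans Ioo_subset_Icc_self
    · rw [← closure_Ioo (hρ.trans (hrs.trans_lt hσ)).ne]
      exact closure_minimal (Rat.denseRange_cast.open_subset_closure_inter isOpen_Ioo)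
        isClosed_closure
  have k1 := key ⟨hρ.le, hrs.trans hσ.le⟩
  have k2 := key ⟨hρ.le.trans hrs, hσ.le⟩
  simp only at k1 k2
  rw [← intervalIntegral.integral_add_adjacent_intervals (hII ρ r hρ0 hρ.le (hrs.trans_lt hs))
    (hII r s hr hrs hs), ← k1] at k2
  linear_combination k2

/-- On almost every horizontal line, `F` is differentiable almost everywhere, with derivative its
weak derivative. -/
lemma ae_ae_hasDerivAt (h : HasWeakDerivFst A B F G) :
    ∀ᵐ y ∂volume.restrict (Ioo 0 B), ∀ᵐ x ∂volume.restrict (Ioo 0 A),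
      HasDerivAt (fun t => F (t, y)) (G (x, y)) x := by
  filter_upwards [h.ae_sub_eq_integral] with y hy
  rw [ae_restrict_iff' measurableSet_Ioo]
  have h1 : ∀ᵐ x, ∀ q : ℚ × ℚ, 0 < (q.1 : ℝ) → (q.1 : ℝ) ≤ q.2 → (q.2 : ℝ) < A →
      x ∈ uIcc (q.1 : ℝ) q.2 → ∀ c ∈ uIcc (q.1 : ℝ) q.2,
        HasDerivAt (fun x => ∫ t in c..x, G (t, y)) (G (x, y)) x := by
    rw [ae_all_iff]
    intro q
    by_cases hq : 0 < (q.1 : ℝ) ∧ (q.1 : ℝ) ≤ q.2 ∧ (q.2 : ℝ) < A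
    · filter_upwards [(hy _ _ hq.1 hq.2.1 hq.2.2).1.ae_hasDerivAt_integral] with y hy _ _ _ using hy
    · exact Eventually.of_forall fun y h1 h2 h3 => absurd ⟨h1, h2, h3⟩ hq
  filter_upwards [h1] with x hx hxA
  obtain ⟨ρ, hρ0, hρ⟩ := exists_rat_btwn hxA.1
  obtain ⟨σ, hσ, hσA⟩ := exists_rat_btwn hxA.2
  have h2 := hx (ρ, σ) hρ0 (hρ.trans hσ).le hσA (mem_uIcc_of_le hρ.le hσ.le) ρ left_mem_uIcc
  refine (h2.add_const (F (ρ, y))).congr_of_eventuallyEq ?_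
  filter_upwards [Ioo_mem_nhds hρ hσ] with t ht
  rw [← (hy ρ t hρ0 ht.1.le (ht.2.trans hσA)).2, sub_add_cancel]

/-- On almost every horizontal line, the increment across the rectangle of a real linear functional
of `F` is at most the integral of the positive part of its derivative. -/
lemma ae_ofReal_sub_le_lintegral (h : HasWeakDerivFst A B F G) (hA : 0 < A) (κ : ℂ →L[ℝ] ℝ) :
    ∀ᵐ y ∂volume.restrict (Ioo 0 B), ENNReal.ofReal (κ (F (A, y)) - κ (F (0, y)))
      ≤ ∫⁻ x in Ioo 0 A, ENNReal.ofReal (κ (G (x, y))) := by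
  filter_upwards [h.ae_sub_eq_integral] with y hy
  have hFy : Continuous fun x => κ (F (x, y)) := by have := h.continuous; fun_prop
  have key : ∀ r s, 0 < r → r ≤ s → s < A → ENNReal.ofReal (κ (F (s, y)) - κ (F (r, y)))
      ≤ ∫⁻ x in Ioo 0 A, ENNReal.ofReal (κ (G (x, y))) := by
    intro r s hr hrs hs
    obtain ⟨hi, he⟩ := hy r s hr hrs hs
    have hi' : IntegrableOn (fun x => G (x, y)) (Ioc r s) := hi.1
    rw [← map_sub, he, intervalIntegral.integral_of_le hrs, ← κ.integral_comp_comm hi']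
    have hm := κ.integrable_comp hi'
    refine (ENNReal.ofReal_le_ofReal
      (integral_mono hm hm.pos_part fun x => le_max_left _ _)).trans ?_
    rw [ofReal_integral_eq_lintegral_ofReal hm.pos_part
      (Eventually.of_forall fun x => le_max_right _ _)]
    refine (lintegral_mono fun x => ?_).trans
      (lintegral_mono_set fun x hx => ⟨hr.trans hx.1, hx.2.trans_lt hs⟩)
    rcases le_total (κ (G (x, y))) 0 with h0 | h0
    · simp [max_eq_right h0]
    · simp [max_eq_left h0]
  have lim : Tendsto (fun ε => ENNReal.ofReal (κ (F (A - ε, y)) - κ (F (ε, y)))) (𝓝[>] 0)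
      (𝓝 (ENNReal.ofReal (κ (F (A, y)) - κ (F (0, y))))) := by
    have hc : Continuous fun ε => ENNReal.ofReal (κ (F (A - ε, y)) - κ (F (ε, y))) :=
      ENNReal.continuous_ofReal.comp ((hFy.comp (continuous_const.sub continuous_id)).sub hFy)
    simpa using (hc.tendsto 0).mono_left (nhdsWithin_le_nhds (s := Ioi 0))
  refine le_of_tendsto lim ?_
  have hev : ∀ᶠ ε : ℝ in 𝓝[>] 0, ε < A / 2 :=
    (eventually_lt_nhds (by linarith)).filter_mono nhdsWithin_le_nhds
  filter_upwards [hev, self_mem_nhdsWithin] with ε hε hpos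
  have hpos : 0 < ε := hpos
  exact key ε (A - ε) hpos (by linarith) (by linarith)

end HasWeakDerivFst

/-! ### The area inequality -/

/-- Egorov's theorem for the difference quotients in a fixed direction. -/
lemma exists_uniform_lineDeriv {g : ℂ → ℂ} (hg : Continuous g) {U : Set ℂ} (hU : MeasurableSet U)
    (hUfin : volume U ≠ ⊤) (v : ℂ)
    (hd : ∀ᵐ z ∂volume.restrict U, LineDifferentiableAt ℝ g z v) {ε : ℝ} (hε : 0 < ε) :
    ∃ t ⊆ U, MeasurableSet t ∧ volume t ≤ ENNReal.ofReal ε ∧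
      ∀ δ > 0, ∃ ρ > 0, ∀ z ∈ U \ t, ∀ s : ℝ, |s| < ρ →
        ‖g (z + s • v) - g z - s • lineDeriv ℝ g z v‖ ≤ δ * |s| := by
  -- The supremum over rational increments is measurable, and bounds all increments by continuity.
  set ψ : ℕ → ℂ → ℝ≥0∞ := fun n z => ⨆ q : {q : ℚ // |(q : ℝ)| < 1 / ((n : ℝ) + 1)},
    ENNReal.ofReal ‖g (z + (q : ℝ) • v) - g z - (q : ℝ) • lineDeriv ℝ g z v‖
      / ENNReal.ofReal |(q : ℝ)| with hψ
  have hψm : ∀ n, Measurable (ψ n) := by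
    intro n
    refine Measurable.iSup fun q => ?_
    refine Measurable.div_const ?_ _
    refine ENNReal.measurable_ofReal.comp (Measurable.norm ?_)
    exact ((hg.comp (continuous_id.add continuous_const)).measurable.sub hg.measurable).sub
      ((measurable_lineDeriv hg).const_smul (q : ℝ))
  have hconv : ∀ᵐ z, z ∈ U → Tendsto (fun n => min (ψ n z) 1) atTop (𝓝 0) := by
    rw [ae_restrict_iff' hU] at hd
    filter_upwards [hd] with z hz hzU
    have hz := (hz hzU).hasLineDerivAt
    rw [HasLineDerivAt, hasDerivAt_iff_isLittleO_nhds_zero] at hz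
    rw [ENNReal.tendsto_atTop_zero]
    intro δ hδ
    obtain ⟨δ', hδ', hδ'δ⟩ := ENNReal.lt_iff_exists_real_btwn.1 hδ
    have hδ'pos : 0 < δ' := ENNReal.ofReal_pos.1 hδ'δ.1
    obtain ⟨ρ, hρ, hball⟩ := Metric.eventually_nhds_iff.1 (Asymptotics.isLittleO_iff.1 hz hδ'pos)
    obtain ⟨N, hN⟩ := exists_nat_one_div_lt hρ
    refine ⟨N, fun n hn => (min_le_left _ _).trans (le_trans ?_ hδ'δ.2.le)⟩
    refine iSup_le fun q => ENNReal.div_le_of_le_mul ?_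
    rw [← ENNReal.ofReal_mul hδ'pos.le]
    refine ENNReal.ofReal_le_ofReal ?_
    have := hball (y := (q : ℝ)) (by
      rw [Real.dist_eq, sub_zero]
      exact q.2.trans ((Nat.one_div_le_one_div hn).trans_lt hN))
    simpa only [zero_add, zero_smul, add_zero, Real.norm_eq_abs] using this
  have hconv' : ∀ᵐ z, z ∈ U → Tendsto (fun n => (min (ψ n z) 1).toReal) atTop (𝓝 0) := by
    filter_upwards [hconv] with z hz hzU
    exact (ENNReal.tendsto_toReal ENNReal.zero_ne_top).comp (hz hzU)
  obtain ⟨t, htU, htm, htv, htu⟩ := tendstoUniformlyOn_of_ae_tendsto (μ := volume)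
    (g := fun _ => (0 : ℝ))
    (fun n => (((hψm n).min measurable_const).ennreal_toReal).stronglyMeasurable)
    stronglyMeasurable_const hU hUfin hconv' hε
  refine ⟨t, htU, htm, htv, fun δ hδ => ?_⟩
  rw [Metric.tendstoUniformlyOn_iff] at htu
  obtain ⟨n, hn⟩ := (htu (min δ 1) (lt_min hδ one_pos)).exists
  refine ⟨1 / ((n : ℝ) + 1), by positivity, fun z hz s hs => ?_⟩
  have h1 : ψ n z ≤ ENNReal.ofReal δ := by
    have h2 := hn z hz
    rw [dist_comm, Real.dist_eq, sub_zero, abs_of_nonneg ENNReal.toReal_nonneg] at h2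
    have h3 : min (ψ n z) 1 ≠ ⊤ := ((min_le_right _ _).trans_lt ENNReal.one_lt_top).ne
    have h4 : min (ψ n z) 1 < 1 := by
      rw [← ENNReal.toReal_lt_toReal h3 ENNReal.one_ne_top, ENNReal.toReal_one]
      exact h2.trans_le (min_le_right _ _)
    have h5 : ψ n z < 1 := by simpa using h4
    rw [min_eq_left h5.le] at h2
    rw [← ENNReal.ofReal_toReal (h5.trans ENNReal.one_lt_top).ne]
    exact ENNReal.ofReal_le_ofReal (h2.le.trans (min_le_left _ _))
  have hclosed : IsClosed {s : ℝ | ‖g (z + s • v) - g z - s • lineDeriv ℝ g z v‖ ≤ δ * |s|} :=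
    isClosed_le (by fun_prop) (by fun_prop)
  have hsub : Metric.ball (0 : ℝ) (1 / ((n : ℝ) + 1)) ∩ range ((↑) : ℚ → ℝ) ⊆
      {s : ℝ | ‖g (z + s • v) - g z - s • lineDeriv ℝ g z v‖ ≤ δ * |s|} := by
    rintro _ ⟨hq, q, rfl⟩
    rw [mem_ball_zero_iff, Real.norm_eq_abs] at hq
    rw [mem_ofPred_eq]
    by_cases hq0 : (q : ℝ) = 0
    · simp [hq0]
    have h2 := (le_iSup (fun q : {q : ℚ // |(q : ℝ)| < 1 / ((n : ℝ) + 1)} =>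
      ENNReal.ofReal ‖g (z + (q : ℝ) • v) - g z - (q : ℝ) • lineDeriv ℝ g z v‖
      / ENNReal.ofReal |(q : ℝ)|) ⟨q, hq⟩).trans h1
    rw [ENNReal.div_le_iff_le_mul (Or.inl (by simpa using hq0)) (Or.inl ENNReal.ofReal_ne_top),
      ← ENNReal.ofReal_mul hδ.le] at h2
    exact (ENNReal.ofReal_le_ofReal_iff (by positivity)).1 h2
  exact closure_minimal hsub hclosed
    (Rat.denseRange_cast.open_subset_closure_inter Metric.isOpen_ball (by
      rwa [mem_ball_zero_iff, Real.norm_eq_abs]))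

/-- The real linear map of `ℂ` with partial derivatives `a` and `b`. -/
noncomputable def ofPartials (a b : ℂ) : ℂ →L[ℝ] ℂ :=
  Complex.reCLM.smulRight a + Complex.imCLM.smulRight b

lemma ofPartials_apply (a b z : ℂ) : ofPartials a b z = z.re • a + z.im • b := rfl

lemma det_ofPartials (a b : ℂ) : (ofPartials a b).det = a.re * b.im - a.im * b.re := by
  rw [ContinuousLinearMap.det, ← LinearMap.det_toMatrix Complex.basisOneI, Matrix.det_fin_two]
  simp [LinearMap.toMatrix_apply, ofPartials_apply]
  ring

/-- If the difference quotients in both coordinate directions converge uniformly on `E`, then the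
restriction to `E` is differentiable at every point of `E`. No assumption is made on corners
of rectangles: a path from `z` to `w` first moves horizontally, controlled at `z`, and then
vertically, controlled at `w`, and the vertical derivative is continuous on `E`. -/
lemma hasFDerivWithinAt_of_uniform {g : ℂ → ℂ} (hg : Continuous g) {E : Set ℂ}
    {d₁ d₂ : ℂ → ℂ}
    (h₁ : ∀ δ > 0, ∃ ρ > 0, ∀ z ∈ E, ∀ s : ℝ, |s| < ρ →
      ‖g (z + s • (1 : ℂ)) - g z - s • d₁ z‖ ≤ δ * |s|)
    (h₂ : ∀ δ > 0, ∃ ρ > 0, ∀ z ∈ E, ∀ s : ℝ, |s| < ρ →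
      ‖g (z + s • Complex.I) - g z - s • d₂ z‖ ≤ δ * |s|) {z : ℂ} (hz : z ∈ E) :
    HasFDerivWithinAt g (ofPartials (d₁ z) (d₂ z)) E z := by
  have hcont : ∀ δ > 0, ∀ᶠ w in 𝓝[E] z, ‖d₂ w - d₂ z‖ ≤ δ := by
    intro δ hδ
    obtain ⟨ρ, hρ, h⟩ := h₂ (δ / 3) (by positivity)
    set s := ρ / 2 with hs
    have hspos : 0 < s := by positivity
    have hsρ : |s| < ρ := by rw [abs_of_pos hspos]; linarith
    have hq : Continuous fun w => g (w + s • Complex.I) - g w := by fun_prop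
    have h3 : ∀ᶠ w in 𝓝[E] z, ‖(g (w + s • Complex.I) - g w) - (g (z + s • Complex.I) - g z)‖
        < δ / 3 * s := by
      have := (Metric.continuous_iff'.1 hq z (δ / 3 * s) (by positivity))
      exact (this.mono fun w hw => by rwa [dist_eq_norm] at hw).filter_mono nhdsWithin_le_nhds
    filter_upwards [h3, self_mem_nhdsWithin] with w hw hwE
    have a1 := h w hwE s hsρ
    have a2 := h z hz s hsρ
    rw [abs_of_pos hspos] at a1 a2
    have : s * ‖d₂ w - d₂ z‖ ≤ s * δ := by
      rw [← abs_of_pos hspos, ← Real.norm_eq_abs, ← norm_smul, Real.norm_eq_abs, abs_of_pos hspos]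
      have e : s • (d₂ w - d₂ z) = ((g (w + s • Complex.I) - g w) - (g (z + s • Complex.I) - g z))
          - (g (w + s • Complex.I) - g w - s • d₂ w)
          + (g (z + s • Complex.I) - g z - s • d₂ z) := by
        rw [smul_sub]; abel
      rw [e]
      refine (norm_add_le _ _).trans ((add_le_add (norm_sub_le _ _) le_rfl).trans ?_)
      linarith
    exact le_of_mul_le_mul_left this hspos
  rw [hasFDerivWithinAt_iff_isLittleO, Asymptotics.isLittleO_iff]
  intro δ hδ
  obtain ⟨ρ₁, hρ₁, k₁⟩ := h₁ (δ / 3) (by positivity)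
  obtain ⟨ρ₂, hρ₂, k₂⟩ := h₂ (δ / 3) (by positivity)
  have hball : ∀ᶠ w in 𝓝[E] z, dist w z < min ρ₁ ρ₂ :=
    (Metric.eventually_nhds_iff.2 ⟨min ρ₁ ρ₂, lt_min hρ₁ hρ₂, fun _ h => h⟩).filter_mono
      nhdsWithin_le_nhds
  filter_upwards [hcont (δ / 3) (by positivity), hball, self_mem_nhdsWithin] with w hw hdist hwE
  rw [dist_eq_norm] at hdist
  have hre : |(w - z).re| ≤ ‖w - z‖ := Complex.abs_re_le_norm _
  have him : |(w - z).im| ≤ ‖w - z‖ := Complex.abs_im_le_norm _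
  have a1 := k₁ z hz (w - z).re (hre.trans_lt (hdist.trans_le (min_le_left _ _)))
  have a2 := k₂ w hwE (-(w - z).im) (by
    rw [abs_neg]; exact him.trans_lt (hdist.trans_le (min_le_right _ _)))
  have hcorner : w + (-(w - z).im) • Complex.I = z + (w - z).re • (1 : ℂ) := by
    apply Complex.ext <;> simp
  rw [hcorner, abs_neg] at a2
  have e : g w - g z - ofPartials (d₁ z) (d₂ z) (w - z)
      = (g (z + (w - z).re • (1 : ℂ)) - g z - (w - z).re • d₁ z)
        - (g (z + (w - z).re • (1 : ℂ)) - g w - (-(w - z).im) • d₂ w)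
        + (w - z).im • (d₂ w - d₂ z) := by
    rw [ofPartials_apply]
    module
  rw [e]
  refine (norm_add_le _ _).trans ((add_le_add (norm_sub_le _ _) le_rfl).trans ?_)
  rw [norm_smul, Real.norm_eq_abs]
  have a3 : |(w - z).im| * ‖d₂ w - d₂ z‖ ≤ ‖w - z‖ * (δ / 3) := by gcongr
  have a4 : δ / 3 * |(w - z).re| ≤ δ / 3 * ‖w - z‖ := by gcongr
  have a5 : δ / 3 * |(w - z).im| ≤ δ / 3 * ‖w - z‖ := by gcongr
  linarith

/-- The area inequality for an injective continuous map with partial derivatives almost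
everywhere. -/
lemma lintegral_abs_jacobian_le {g : ℂ → ℂ} (hg : Continuous g) {U : Set ℂ}
    (hU : MeasurableSet U) (hUfin : volume U ≠ ⊤) (hinj : InjOn g U)
    (hd₁ : ∀ᵐ z ∂volume.restrict U, LineDifferentiableAt ℝ g z 1)
    (hd₂ : ∀ᵐ z ∂volume.restrict U, LineDifferentiableAt ℝ g z Complex.I) :
    ∫⁻ z in U, ENNReal.ofReal |(lineDeriv ℝ g z 1).re * (lineDeriv ℝ g z Complex.I).im
      - (lineDeriv ℝ g z 1).im * (lineDeriv ℝ g z Complex.I).re| ≤ volume (g '' U) := by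
  set h : ℂ → ℝ≥0∞ := fun z => ENNReal.ofReal |(lineDeriv ℝ g z 1).re *
    (lineDeriv ℝ g z Complex.I).im - (lineDeriv ℝ g z 1).im * (lineDeriv ℝ g z Complex.I).re|
    with hh
  have hhm : Measurable h := by
    have m1 : Measurable fun z => lineDeriv ℝ g z 1 := measurable_lineDeriv hg
    have m2 : Measurable fun z => lineDeriv ℝ g z Complex.I := measurable_lineDeriv hg
    have m3 := ((Complex.measurable_re.comp m1).mul (Complex.measurable_im.comp m2)).sub
      ((Complex.measurable_im.comp m1).mul (Complex.measurable_re.comp m2))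
    exact ENNReal.measurable_ofReal.comp (measurable_norm.comp m3)
  have hε : ∀ n : ℕ, (0 : ℝ) < (1 / 2) ^ n := fun n => by positivity
  choose t₁ ht₁U ht₁m ht₁v ht₁u using
    fun n => exists_uniform_lineDeriv hg hU hUfin 1 hd₁ (hε n)
  choose t₂ ht₂U ht₂m ht₂v ht₂u using
    fun n => exists_uniform_lineDeriv hg hU hUfin Complex.I hd₂ (hε n)
  set E : ℕ → Set ℂ := fun n => U \ (t₁ n ∪ t₂ n) with hE
  have hEm : ∀ n, MeasurableSet (E n) := fun n => hU.diff ((ht₁m n).union (ht₂m n))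
  have hEle : ∀ n, ∫⁻ z in U, (E n).indicator h z ≤ volume (g '' U) := by
    intro n
    rw [lintegral_indicator (hEm n), Measure.restrict_restrict (hEm n),
      inter_eq_self_of_subset_left (show E n ⊆ U from sdiff_subset)]
    have := lintegral_abs_det_fderiv_eq_addHaar_image volume (hEm n)
      (f' := fun z => ofPartials (lineDeriv ℝ g z 1) (lineDeriv ℝ g z Complex.I))
      (fun z hz => hasFDerivWithinAt_of_uniform hg (E := E n)
        (d₁ := fun z => lineDeriv ℝ g z 1) (d₂ := fun z => lineDeriv ℝ g z Complex.I)
        (fun δ hδ => (ht₁u n δ hδ).imp fun ρ hρ => ⟨hρ.1, fun z hz =>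
          hρ.2 z ⟨hz.1, fun h => hz.2 (Or.inl h)⟩⟩)
        (fun δ hδ => (ht₂u n δ hδ).imp fun ρ hρ => ⟨hρ.1, fun z hz =>
          hρ.2 z ⟨hz.1, fun h => hz.2 (Or.inr h)⟩⟩) hz)
      (hinj.mono sdiff_subset)
    simp only [det_ofPartials] at this
    rw [this]
    exact measure_mono (image_mono sdiff_subset)
  have hsum : ∑' n, volume (t₁ n ∪ t₂ n) ≠ ⊤ := by
    have hs : Summable fun n : ℕ => (1 / 2 : ℝ) ^ n + (1 / 2) ^ n :=
      summable_geometric_two.add summable_geometric_two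
    refine ne_top_of_le_ne_top hs.tsum_ofReal_ne_top (ENNReal.tsum_le_tsum fun n => ?_)
    rw [ENNReal.ofReal_add (hε n).le (hε n).le]
    exact (measure_union_le _ _).trans (add_le_add (ht₁v n) (ht₂v n))
  have hev := ae_eventually_notMem hsum
  calc ∫⁻ z in U, h z ≤ ∫⁻ z in U, liminf (fun n => (E n).indicator h z) atTop := by
        refine lintegral_mono_ae ?_
        refine (ae_restrict_iff' hU).2 ?_
        filter_upwards [hev] with z hz hzU
        have : ∀ᶠ n in atTop, (E n).indicator h z = h z := by
          filter_upwards [hz] with n hn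
          exact indicator_of_mem (show z ∈ E n from ⟨hzU, hn⟩) _
        rw [liminf_congr this, liminf_const]
    _ ≤ liminf (fun n => ∫⁻ z in U, (E n).indicator h z) atTop :=
        lintegral_liminf_le fun n => hhm.indicator (hEm n)
    _ ≤ volume (g '' U) := by
        refine liminf_le_of_le (by isBoundedDefault) fun b hb => ?_
        obtain ⟨n, hn⟩ := hb.exists
        exact hn.trans (hEle n)

/-! ### Weak partial derivatives of plane maps -/

/-- Transfer of a weak directional derivative in `U` to a rectangle, for linear coordinates `e` that
preserve the area and whose first axis points in the given direction. -/
lemma IsWeakPartial.hasWeakDerivFst {U : Set ℂ} {A B : ℝ} {f f' g : ℂ → ℂ}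
    {e : (ℝ × ℝ) ≃L[ℝ] ℂ} (he : MeasurePreserving e)
    (hU : e ⁻¹' U = Ioo 0 A ×ˢ Ioo 0 B) (hf' : Continuous f') (hff' : EqOn f f' U)
    (h : IsWeakPartial U (e (1, 0)) f g) :
    HasWeakDerivFst A B (fun p => f' (e p)) (fun p => g (e p)) := by
  have hemb : MeasurableEmbedding e := e.toHomeomorph.measurableEmbedding
  have hUimg : U = e '' (Ioo 0 A ×ˢ Ioo 0 B) := by
    rw [← hU, image_preimage_eq _ e.surjective]
  have hUo : IsOpen U := by
    rw [hUimg]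
    exact e.toHomeomorph.isOpenMap _ (isOpen_Ioo.prod isOpen_Ioo)
  have hUm : MeasurableSet U := hUo.measurableSet
  refine ⟨hf'.comp e.continuous, ?_, ?_⟩
  · intro r s r' s' hr hs hr' hs'
    rw [Measure.prod_restrict]
    have hK : IsCompact (e '' (Icc r s ×ˢ Icc r' s')) :=
      (isCompact_Icc.prod isCompact_Icc).image e.continuous
    have hKU : e '' (Icc r s ×ˢ Icc r' s') ⊆ U := by
      rw [hUimg]
      exact image_mono (prod_mono (fun x hx => ⟨hr.trans_le hx.1, hx.2.trans_lt hs⟩)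
        (fun x hx => ⟨hr'.trans_le hx.1, hx.2.trans_lt hs'⟩))
    have := (he.integrableOn_comp_preimage hemb).2 (h.2.1.integrableOn_compact_subset hKU hK)
    rwa [preimage_image_eq _ e.injective] at this
  · intro a b ha hac has hb hbc hbs
    set η : ℂ → ℝ := fun z => a (e.symm z).1 * b (e.symm z).2 with hη
    have hηs : ContDiff ℝ ∞ η :=
      (ha.comp (contDiff_fst.comp e.symm.contDiff)).mul
        (hb.comp (contDiff_snd.comp e.symm.contDiff))
    have hsub : tsupport η ⊆ e '' (tsupport a ×ˢ tsupport b) := by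
      refine closure_minimal (fun z hz => ?_)
        ((hac.isCompact.prod hbc.isCompact).image e.continuous).isClosed
      refine ⟨e.symm z, ⟨subset_tsupport _ ?_, subset_tsupport _ ?_⟩, e.apply_symm_apply z⟩
      · exact left_ne_zero_of_mul hz
      · exact right_ne_zero_of_mul hz
    have hηc : HasCompactSupport η :=
      ((hac.isCompact.prod hbc.isCompact).image e.continuous).of_isClosed_subset
        (isClosed_tsupport _) hsub
    have hηU : tsupport η ⊆ U := by
      rw [hUimg]
      exact hsub.trans (image_mono (prod_mono has hbs))
    have hfd : ∀ p, fderiv ℝ η (e p) (e (1, 0)) = deriv a p.1 * b p.2 := by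
      intro p
      have h1 : HasFDerivAt (fun z : ℂ => (e.symm z).1)
          ((ContinuousLinearMap.fst ℝ ℝ ℝ).comp (e.symm : ℂ →L[ℝ] ℝ × ℝ)) (e p) :=
        ((ContinuousLinearMap.fst ℝ ℝ ℝ).comp (e.symm : ℂ →L[ℝ] ℝ × ℝ)).hasFDerivAt
      have h2 : HasFDerivAt (fun z : ℂ => (e.symm z).2)
          ((ContinuousLinearMap.snd ℝ ℝ ℝ).comp (e.symm : ℂ →L[ℝ] ℝ × ℝ)) (e p) :=
        ((ContinuousLinearMap.snd ℝ ℝ ℝ).comp (e.symm : ℂ →L[ℝ] ℝ × ℝ)).hasFDerivAt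
      have da : HasDerivAt a (deriv a p.1) (e.symm (e p)).1 := by
        rw [e.symm_apply_apply]
        exact (ha.differentiable (by simp)).differentiableAt.hasDerivAt
      have db : HasDerivAt b (deriv b p.2) (e.symm (e p)).2 := by
        rw [e.symm_apply_apply]
        exact (hb.differentiable (by simp)).differentiableAt.hasDerivAt
      have h3 := (da.comp_hasFDerivAt (e p) h1).mul (db.comp_hasFDerivAt (e p) h2)
      have h4 : fderiv ℝ η (e p) = _ := h3.fderiv
      rw [h4]
      simp [mul_comm]
    have key := h.2.2 η hηs hηc hηU
    rw [← he.setIntegral_preimage_emb hemb, ← he.setIntegral_preimage_emb hemb, hU] at key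
    rw [Measure.prod_restrict]
    refine Eq.trans ?_ (key.trans ?_)
    · refine setIntegral_congr_fun (measurableSet_Ioo.prod measurableSet_Ioo) fun p hp => ?_
      have hp' : e p ∈ U := by rw [hUimg]; exact mem_image_of_mem _ hp
      simp only [hfd, hff' hp']
    · simp only [hη, e.symm_apply_apply]
      rfl

section Coordinates

variable {U : Set ℂ} {A B : ℝ} {f' g : ℂ → ℂ} {e : (ℝ × ℝ) ≃L[ℝ] ℂ}

lemma measurePreserving_restrict_prod (he : MeasurePreserving e)
    (hU : e ⁻¹' U = Ioo 0 A ×ˢ Ioo 0 B) :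
    MeasurePreserving e ((volume.restrict (Ioo 0 A)).prod (volume.restrict (Ioo 0 B)))
      (volume.restrict U) := by
  have := he.restrict_preimage_emb e.toHomeomorph.measurableEmbedding U
  rwa [hU, Measure.volume_eq_prod, ← Measure.prod_restrict] at this

lemma ae_restrict_of_ae_prod (he : MeasurePreserving e) (hU : e ⁻¹' U = Ioo 0 A ×ˢ Ioo 0 B)
    {P : ℂ → Prop}
    (h : ∀ᵐ p ∂(volume.restrict (Ioo 0 A)).prod (volume.restrict (Ioo 0 B)), P (e p)) :
    ∀ᵐ z ∂volume.restrict U, P z := by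
  have := (measurePreserving_restrict_prod he hU).map_eq
  rw [← this]
  exact (e.toHomeomorph.measurableEmbedding.ae_map_iff).2 h

lemma ae_prod_of_ae_restrict (he : MeasurePreserving e) (hU : e ⁻¹' U = Ioo 0 A ×ˢ Ioo 0 B)
    {P : ℂ → Prop} (h : ∀ᵐ z ∂volume.restrict U, P z) :
    ∀ᵐ p ∂(volume.restrict (Ioo 0 A)).prod (volume.restrict (Ioo 0 B)), P (e p) :=
  (measurePreserving_restrict_prod he hU).quasiMeasurePreserving.ae h

/-- Almost every line parallel to the first axis meets a null set in a null set. -/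
lemma ae_ae_of_ae_restrict (he : MeasurePreserving e) (hU : e ⁻¹' U = Ioo 0 A ×ˢ Ioo 0 B)
    {P : ℂ → Prop} (h : ∀ᵐ z ∂volume.restrict U, P z) :
    ∀ᵐ y ∂volume.restrict (Ioo 0 B), ∀ᵐ x ∂volume.restrict (Ioo 0 A), P (e (x, y)) :=
  Measure.ae_ae_of_ae_prod (Measure.measurePreserving_swap.quasiMeasurePreserving.ae
    (ae_prod_of_ae_restrict he hU h))

/-- The classical directional derivative of a continuous Sobolev map exists almost everywhere and is
its weak derivative. -/
lemma HasWeakDerivFst.ae_lineDeriv_eq (he : MeasurePreserving e)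
    (hU : e ⁻¹' U = Ioo 0 A ×ˢ Ioo 0 B) (hf' : Continuous f')
    (hg : AEStronglyMeasurable g (volume.restrict U))
    (h : HasWeakDerivFst A B (fun p => f' (e p)) (fun p => g (e p))) :
    ∀ᵐ z ∂volume.restrict U,
      LineDifferentiableAt ℝ f' z (e (1, 0)) ∧ lineDeriv ℝ f' z (e (1, 0)) = g z := by
  set v := e (1, 0) with hv
  have hm : MeasurableSet {z | LineDifferentiableAt ℝ f' z v ∧ lineDeriv ℝ f' z v = hg.mk g z} :=
    (measurableSet_lineDifferentiableAt hf').inter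
      (measurableSet_eq_fun (measurable_lineDeriv hf') hg.stronglyMeasurable_mk.measurable)
  have key : ∀ᵐ z ∂volume.restrict U,
      LineDifferentiableAt ℝ f' z v ∧ lineDeriv ℝ f' z v = hg.mk g z := by
    refine ae_restrict_of_ae_prod he hU ?_
    have hm' : MeasurableSet {p : ℝ × ℝ | LineDifferentiableAt ℝ f' (e p) v ∧
        lineDeriv ℝ f' (e p) v = hg.mk g (e p)} := hm.preimage e.continuous.measurable
    rw [Measure.ae_prod_iff_ae_ae hm', Measure.ae_ae_comm hm']
    filter_upwards [h.ae_ae_hasDerivAt, ae_ae_of_ae_restrict he hU hg.ae_eq_mk] with y hy hy'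
    filter_upwards [hy, hy'] with x hx hx'
    have hl : HasLineDerivAt ℝ f' (g (e (x, y))) (e (x, y)) v := by
      have h0 : HasDerivAt (fun t => f' (e (t, y))) (g (e (x, y))) (x + 0) := by simpa using hx
      have h1 := h0.comp_const_add
      rw [HasLineDerivAt]
      convert h1 using 3 with t
      rw [hv, ← map_smul, ← map_add]
      simp
    exact ⟨hl.lineDifferentiableAt, hl.lineDeriv.trans hx'⟩
  filter_upwards [key, hg.ae_eq_mk] with z hz hz'
  exact ⟨hz.1, hz.2.trans hz'.symm⟩

/-- The length-area estimate: the weighted integral of the positive part of a directional derivative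
bounds the weighted increments across the rectangle. -/
lemma HasWeakDerivFst.lintegral_mul_le (he : MeasurePreserving e)
    (hU : e ⁻¹' U = Ioo 0 A ×ˢ Ioo 0 B) (hA : 0 < A)
    (hg : AEStronglyMeasurable g (volume.restrict U))
    (h : HasWeakDerivFst A B (fun p => f' (e p)) (fun p => g (e p))) (κ : ℂ →L[ℝ] ℝ)
    {wt : ℝ → ℝ≥0∞} (hwt : AEMeasurable wt (volume.restrict (Ioo 0 B))) :
    ∫⁻ y in Ioo 0 B, wt y * ENNReal.ofReal (κ (f' (e (A, y))) - κ (f' (e (0, y))))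
      ≤ ∫⁻ z in U, wt (e.symm z).2 * ENNReal.ofReal (κ (g z)) := by
  have hmp := measurePreserving_restrict_prod he hU
  have hgm : AEMeasurable (fun p => ENNReal.ofReal (κ (g (e p))))
      ((volume.restrict (Ioo 0 A)).prod (volume.restrict (Ioo 0 B))) :=
    (κ.continuous.comp_aestronglyMeasurable
      hg).aemeasurable.ennreal_ofReal.comp_quasiMeasurePreserving hmp.quasiMeasurePreserving
  have hwtm : AEMeasurable (fun p : ℝ × ℝ => wt p.2)
      ((volume.restrict (Ioo 0 A)).prod (volume.restrict (Ioo 0 B))) :=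
    hwt.comp_quasiMeasurePreserving Measure.quasiMeasurePreserving_snd
  rw [← hmp.lintegral_comp_emb e.toHomeomorph.measurableEmbedding]
  simp only [e.symm_apply_apply]
  rw [lintegral_prod_symm (fun p => wt p.2 * ENNReal.ofReal (κ (g (e p)))) (hwtm.mul hgm)]
  refine lintegral_mono_ae ?_
  filter_upwards [h.ae_ofReal_sub_le_lintegral hA κ,
    Measure.ae_ae_of_ae_prod (Measure.measurePreserving_swap.quasiMeasurePreserving.ae
      hgm.ae_eq_mk)] with y hy hy'
  have hym : AEMeasurable (fun x => ENNReal.ofReal (κ (g (e (x, y)))))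
      (volume.restrict (Ioo 0 A)) :=
    ⟨fun x => hgm.mk _ (x, y), hgm.measurable_mk.comp (measurable_id.prodMk measurable_const), hy'⟩
  rw [lintegral_const_mul'' _ hym]
  gcongr

end Coordinates

/-- The coordinates `(x, y) ↦ x + i y`. -/
noncomputable def coordXY : (ℝ × ℝ) ≃L[ℝ] ℂ := Complex.equivRealProdCLM.symm

/-- The coordinates `(y, x) ↦ x + i y`. -/
noncomputable def coordYX : (ℝ × ℝ) ≃L[ℝ] ℂ :=
  (ContinuousLinearEquiv.prodComm ℝ ℝ ℝ).trans Complex.equivRealProdCLM.symm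

lemma coordXY_apply (p : ℝ × ℝ) : coordXY p = ⟨p.1, p.2⟩ :=
  Complex.equivRealProdCLM_symm_apply p |>.trans (by apply Complex.ext <;> simp)

lemma coordYX_apply (p : ℝ × ℝ) : coordYX p = ⟨p.2, p.1⟩ := coordXY_apply p.swap

lemma coordXY_one_zero : coordXY (1, 0) = 1 := by
  rw [coordXY_apply]; apply Complex.ext <;> simp

lemma coordYX_one_zero : coordYX (1, 0) = Complex.I := by
  rw [coordYX_apply]; apply Complex.ext <;> simp

lemma coordXY_symm_snd (z : ℂ) : (coordXY.symm z).2 = z.im := rfl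

lemma coordYX_symm_snd (z : ℂ) : (coordYX.symm z).2 = z.re := rfl

lemma measurePreserving_coordXY : MeasurePreserving coordXY :=
  Complex.volume_preserving_equiv_real_prod.symm

lemma measurePreserving_coordYX : MeasurePreserving coordYX :=
  measurePreserving_coordXY.comp Measure.measurePreserving_swap

lemma coordXY_preimage (ℓ : ℝ) : coordXY ⁻¹' openRect ℓ = Ioo 0 ℓ ×ˢ Ioo 0 1 := by
  ext p
  simp only [mem_preimage, coordXY_apply]
  rfl

lemma coordYX_preimage (ℓ : ℝ) : coordYX ⁻¹' openRect ℓ = Ioo 0 1 ×ˢ Ioo 0 ℓ := by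
  ext p
  simp only [mem_preimage, coordYX_apply]
  exact and_comm

lemma isOpen_openRect (ℓ : ℝ) : IsOpen (openRect ℓ) :=
  (isOpen_Ioo.preimage Complex.continuous_re).inter (isOpen_Ioo.preimage Complex.continuous_im)

lemma volume_openRect (ℓ : ℝ) : volume (openRect ℓ) = ENNReal.ofReal ℓ := by
  rw [← measurePreserving_coordXY.measure_preimage (isOpen_openRect ℓ).nullMeasurableSet,
    coordXY_preimage, Measure.volume_eq_prod, Measure.prod_prod]
  simp

lemma volume_closedRect (L : ℝ) : volume (closedRect L) = ENNReal.ofReal L := by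
  have hm : MeasurableSet (closedRect L) :=
    (measurableSet_Icc.preimage Complex.measurable_re).inter
      (measurableSet_Icc.preimage Complex.measurable_im)
  have : coordXY ⁻¹' closedRect L = Icc 0 L ×ˢ Icc 0 1 := by
    ext p
    simp only [mem_preimage, coordXY_apply]
    rfl
  rw [← measurePreserving_coordXY.measure_preimage hm.nullMeasurableSet, this,
    Measure.volume_eq_prod, Measure.prod_prod]
  simp

lemma MeasureTheory.LocallyIntegrableOn.integrable_smul_of_tsupport_subset {U : Set ℂ}
    {g : ℂ → ℂ} (hg : LocallyIntegrableOn g U) {η : ℂ → ℝ} (hη : Continuous η)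
    (hηc : HasCompactSupport η) (hηU : tsupport η ⊆ U) : Integrable (fun z => η z • g z) := by
  obtain ⟨C, hC⟩ := hηc.exists_bound_of_continuous hη
  have h1 : IntegrableOn (fun z => η z • g z) (tsupport η) :=
    (hg.integrableOn_compact_subset hηU hηc.isCompact).bdd_smul C
      hη.aestronglyMeasurable (Eventually.of_forall hC)
  refine (integrableOn_iff_integrable_of_support_subset fun z hz => ?_).1 h1
  exact subset_tsupport _ (left_ne_zero_of_smul hz)

/-- Weak derivatives are unique up to null sets. -/
lemma IsWeakPartial.ae_eq {U : Set ℂ} (hU : IsOpen U) {v : ℂ} {f g g' : ℂ → ℂ}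
    (h : IsWeakPartial U v f g) (h' : IsWeakPartial U v f g') : g =ᵐ[volume.restrict U] g' := by
  have key := hU.ae_eq_zero_of_integral_contDiff_smul_eq_zero (μ := volume)
    (h.2.1.sub h'.2.1) ?_
  · rw [EventuallyEq, ae_restrict_iff' hU.measurableSet]
    filter_upwards [key] with z hz hzU using sub_eq_zero.1 (hz hzU)
  · intro η hη hηc hηU
    have h0 : ∀ z, z ∉ U → η z = 0 := fun z hz =>
      image_eq_zero_of_notMem_tsupport fun hn => hz (hηU hn)
    have hi : ∀ {g : ℂ → ℂ}, LocallyIntegrableOn g U → IntegrableOn (fun z => η z • g z) U :=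
      fun hg => (hg.integrable_smul_of_tsupport_subset hη.continuous hηc hηU).integrableOn
    rw [← setIntegral_eq_integral_of_forall_compl_eq_zero (s := U)
      (fun z hz => by rw [h0 z hz, zero_smul])]
    simp only [Pi.sub_apply, smul_sub]
    rw [integral_sub (hi h.2.1) (hi h'.2.1)]
    have e1 := h.2.2 η hη hηc hηU
    have e2 := h'.2.2 η hη hηc hηU
    rw [sub_eq_zero]
    exact neg_injective (e1.symm.trans e2)

lemma isWeakPartial_weakPartial {U : Set ℂ} {v : ℂ} {f : ℂ → ℂ} (h : ∃ g, IsWeakPartial U v f g) :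
    IsWeakPartial U v f (weakPartial U v f) := by
  rw [weakPartial, dif_pos h]
  exact h.choose_spec

lemma weakPartial_congr {U : Set ℂ} (hU : MeasurableSet U) {v : ℂ} {f f' : ℂ → ℂ}
    (h : EqOn f f' U) : weakPartial U v f = weakPartial U v f' := by
  have : IsWeakPartial U v f = IsWeakPartial U v f' := by
    funext g
    have h1 : LocallyIntegrableOn f U ↔ LocallyIntegrableOn f' U := by
      have aux : ∀ {f f' : ℂ → ℂ}, EqOn f f' U → LocallyIntegrableOn f U →
          LocallyIntegrableOn f' U := by
        intro f f' h hf x hx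
        obtain ⟨s, hs, hfs⟩ := hf x hx
        refine ⟨s ∩ U, inter_mem hs self_mem_nhdsWithin, ?_⟩
        have h2 : IntegrableOn f (s ∩ U) := hfs.mono_set inter_subset_left
        refine h2.congr ?_
        have h3 : ∀ᵐ z ∂volume.restrict U, f z = f' z :=
          (ae_restrict_iff' hU).2 (Eventually.of_forall fun z hz => h hz)
        exact ae_restrict_of_ae_restrict_of_subset inter_subset_right h3
      exact ⟨aux h, aux h.symm⟩
    have h2 : ∀ η : ℂ → ℝ, ∫ z in U, (fderiv ℝ η z v) • f z = ∫ z in U, (fderiv ℝ η z v) • f' z :=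
      fun η => setIntegral_congr_fun hU fun z hz => by simp only [h hz]
    simp only [IsWeakPartial, h1, h2]
  open Classical in
  exact congrArg (fun P : (ℂ → ℂ) → Prop => if h : ∃ g, P g then h.choose else 0) this

/-! ### The stretch map -/

lemma setIntegral_deriv_smul_eq_neg {A : ℝ} (hA : 0 < A) {v a : ℝ → ℝ}
    (hv : AbsolutelyContinuousOnInterval v 0 A) (ha : ContDiff ℝ ∞ a)
    (has : tsupport a ⊆ Ioo 0 A) (β κ : ℂ) :
    ∫ x in Ioo 0 A, deriv a x • (β * v x + κ)
      = -∫ x in Ioo 0 A, a x • (β * ((deriv v x : ℝ) : ℂ)) := by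
  have haA : AbsolutelyContinuousOnInterval a 0 A :=
    (ha.of_le (by simp)).contDiffOn.absolutelyContinuousOnInterval
  have hda : Continuous (deriv a) := ha.continuous_deriv (by simp)
  have a0 : a 0 = 0 := image_eq_zero_of_notMem_tsupport fun h => lt_irrefl _ (has h).1
  have aA : a A = 0 := image_eq_zero_of_notMem_tsupport fun h => lt_irrefl _ (has h).2
  have h1 := haA.integral_mul_deriv_eq_deriv_mul hv
  have h2 := haA.integral_deriv_eq_sub
  rw [a0, aA] at h1 h2
  simp only [zero_mul, sub_zero, zero_sub] at h1 h2
  rw [← integral_Ioc_eq_integral_Ioo, ← integral_Ioc_eq_integral_Ioo,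
    ← intervalIntegral.integral_of_le hA.le, ← intervalIntegral.integral_of_le hA.le]
  have i1 : IntervalIntegrable (fun x => ((deriv a x * v x : ℝ) : ℂ)) volume 0 A :=
    have h := (hda.intervalIntegrable 0 A).mul_continuousOn hv.continuousOn
    ⟨Integrable.ofReal h.1, Integrable.ofReal h.2⟩
  have i2 : IntervalIntegrable (fun x => ((deriv a x : ℝ) : ℂ)) volume 0 A :=
    have h := hda.intervalIntegrable (μ := volume) 0 A
    ⟨Integrable.ofReal h.1, Integrable.ofReal h.2⟩
  have e1 : ∀ x, deriv a x • (β * v x + κ)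
      = β * ((deriv a x * v x : ℝ) : ℂ) + κ * ((deriv a x : ℝ) : ℂ) := by
    intro x
    rw [Complex.real_smul]
    push_cast
    ring
  have e2 : ∀ x, a x • (β * ((deriv v x : ℝ) : ℂ)) = β * ((a x * deriv v x : ℝ) : ℂ) := by
    intro x
    rw [Complex.real_smul]
    push_cast
    ring
  simp only [e1, e2]
  rw [intervalIntegral.integral_add (i1.const_mul β) (i2.const_mul κ),
    intervalIntegral.integral_const_mul, intervalIntegral.integral_const_mul,
    intervalIntegral.integral_const_mul, intervalIntegral.integral_ofReal,
    intervalIntegral.integral_ofReal, intervalIntegral.integral_ofReal, h1, h2]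
  push_cast
  ring

/-- A sum of an absolutely continuous function of the first coordinate and a continuous function of
the second one has the expected weak derivative along the first coordinate. -/
lemma isWeakPartial_of_coord {U : Set ℂ} {A B : ℝ} {e : (ℝ × ℝ) ≃L[ℝ] ℂ} (he : MeasurePreserving e)
    (hU : e ⁻¹' U = Ioo 0 A ×ˢ Ioo 0 B) (hA : 0 < A) {v : ℝ → ℝ}
    (hv : AbsolutelyContinuousOnInterval v 0 A) (β : ℂ) {κ : ℝ → ℂ}
    (hκ : ContinuousOn κ (Ioo 0 B)) {f : ℂ → ℂ}
    (hf : ∀ p ∈ Ioo 0 A ×ˢ Ioo 0 B, f (e p) = β * v p.1 + κ p.2) :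
    IsWeakPartial U (e (1, 0)) f (fun z => β * ((deriv v (e.symm z).1 : ℝ) : ℂ)) := by
  have hemb : MeasurableEmbedding e := e.toHomeomorph.measurableEmbedding
  have hUo : IsOpen U := by
    have : U = e '' (Ioo 0 A ×ˢ Ioo 0 B) := by rw [← hU, image_preimage_eq _ e.surjective]
    rw [this]
    exact e.toHomeomorph.isOpenMap _ (isOpen_Ioo.prod isOpen_Ioo)
  have hmp := measurePreserving_restrict_prod he hU
  have hmem : ∀ z ∈ U, e.symm z ∈ Ioo 0 A ×ˢ Ioo 0 B := by
    intro z hz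
    rw [← hU, mem_preimage, e.apply_symm_apply]
    exact hz
  have hvc : ContinuousOn v (Ioo 0 A) := by
    refine hv.continuousOn.mono ?_
    rw [uIcc_of_le hA.le]
    exact Ioo_subset_Icc_self
  have hfl : LocallyIntegrableOn f U := by
    refine ContinuousOn.locallyIntegrableOn ?_ hUo.measurableSet
    have hc : ContinuousOn (fun z => β * v (e.symm z).1 + κ (e.symm z).2) U := by
      refine (continuousOn_const.mul ?_).add ?_
      · exact Complex.continuous_ofReal.comp_continuousOn (hvc.comp
          (continuous_fst.comp e.symm.continuous).continuousOn fun z hz => (hmem z hz).1)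
      · exact hκ.comp (continuous_snd.comp e.symm.continuous).continuousOn
          fun z hz => (hmem z hz).2
    refine hc.congr fun z hz => ?_
    have := hf _ (hmem z hz)
    rwa [e.apply_symm_apply] at this
  have hgl : LocallyIntegrableOn (fun z => β * ((deriv v (e.symm z).1 : ℝ) : ℂ)) U := by
    refine IntegrableOn.locallyIntegrableOn ?_
    refine (hmp.integrable_comp_emb hemb).1 ?_
    have h1 : Integrable (fun x => β * ((deriv v x : ℝ) : ℂ)) (volume.restrict (Ioo 0 A)) :=
      (Integrable.ofReal (hv.intervalIntegrable_deriv.1.mono_set Ioo_subset_Ioc_self)).const_mul β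
    simpa [Function.comp_def] using h1.comp_fst (volume.restrict (Ioo 0 B))
  refine ⟨hfl, hgl, fun η hη hηc hηU => ?_⟩
  have hd : Continuous fun z => fderiv ℝ η z (e (1, 0)) :=
    (hη.continuous_fderiv (by simp)).clm_apply continuous_const
  have hds : tsupport (fun z => fderiv ℝ η z (e (1, 0))) ⊆ tsupport η :=
    tsupport_fderiv_apply_subset ℝ (e (1, 0))
  have i1 := (hfl.integrable_smul_of_tsupport_subset hd
    (hηc.of_isClosed_subset (isClosed_tsupport _) hds) (hds.trans hηU)).restrict (s := U)
  have i2 := (hgl.integrable_smul_of_tsupport_subset hη.continuous hηc hηU).restrict (s := U)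
  rw [← hmp.integrable_comp_emb hemb] at i1 i2
  rw [← hmp.integral_comp hemb, ← hmp.integral_comp hemb]
  have f1 := integral_prod_symm _ i1
  have f2 := integral_prod_symm _ i2
  simp only [Function.comp_def] at f1 f2
  rw [f1, f2, ← integral_neg]
  refine setIntegral_congr_fun measurableSet_Ioo fun y hy => ?_
  simp only [e.symm_apply_apply]
  have hline : ∀ x, HasDerivAt (fun x => e (x, y)) (e (1, 0)) x := by
    intro x
    have h1 : HasDerivAt (fun x : ℝ => (x, y)) ((1 : ℝ), (0 : ℝ)) x :=
      (hasDerivAt_id x).prodMk (hasDerivAt_const x y)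
    exact e.hasFDerivAt.comp_hasDerivAt x h1
  have hlc : ContDiff ℝ ∞ fun x => e (x, y) :=
    e.contDiff.comp (contDiff_id.prodMk contDiff_const)
  have hderiv : ∀ x, deriv (fun x => η (e (x, y))) x = fderiv ℝ η (e (x, y)) (e (1, 0)) := by
    intro x
    exact (((hη.differentiable (by simp)).differentiableAt.hasFDerivAt).comp_hasDerivAt x
      (hline x)).deriv
  have hsub : tsupport (fun x => η (e (x, y))) ⊆ Ioo 0 A := by
    have h1 : tsupport (fun x => η (e (x, y))) ⊆ (fun x => e (x, y)) ⁻¹' tsupport η :=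
      closure_minimal (fun x hx => subset_tsupport _ hx)
        ((isClosed_tsupport η).preimage hlc.continuous)
    intro x hx
    have h2 : (x, y) ∈ e ⁻¹' U := hηU (h1 hx)
    rw [hU] at h2
    exact h2.1
  have key := setIntegral_deriv_smul_eq_neg hA hv (hη.comp hlc) hsub β (κ y)
  refine Eq.trans ?_ key
  refine setIntegral_congr_fun measurableSet_Ioo fun x hx => ?_
  rw [hf (x, y) ⟨hx, hy⟩]
  simp only [Function.comp_def, hderiv]

section Stretch

variable {ℓ : ℝ} {u : ℝ → ℝ}

lemma isWeakPartial_one_stretchMap (hℓ : 0 < ℓ) (hu : AbsolutelyContinuousOnInterval u 0 ℓ) :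
    IsWeakPartial (openRect ℓ) 1 (stretchMap u) (fun z => ((deriv u z.re : ℝ) : ℂ)) := by
  have := isWeakPartial_of_coord (f := stretchMap u) (κ := fun y => (y : ℂ) * Complex.I)
    measurePreserving_coordXY (coordXY_preimage ℓ)
    hℓ hu 1 (by fun_prop) (fun p _ => by
      rw [coordXY_apply, stretchMap, one_mul, Complex.mk_eq_add_mul_I])
  rw [coordXY_one_zero] at this
  simp only [one_mul] at this
  exact this

lemma isWeakPartial_I_stretchMap (hℓ : 0 < ℓ) (hu : AbsolutelyContinuousOnInterval u 0 ℓ) :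
    IsWeakPartial (openRect ℓ) Complex.I (stretchMap u) (fun _ => Complex.I) := by
  have hc : ContinuousOn u (Ioo 0 ℓ) := by
    refine hu.continuousOn.mono ?_
    rw [uIcc_of_le hℓ.le]
    exact Ioo_subset_Icc_self
  have := isWeakPartial_of_coord (f := stretchMap u) (κ := fun x => (u x : ℂ)) (v := id)
    measurePreserving_coordYX (coordYX_preimage ℓ)
    one_pos (contDiff_id.contDiffOn.absolutelyContinuousOnInterval) Complex.I
    (Complex.continuous_ofReal.comp_continuousOn hc) (fun p _ => by
      rw [coordYX_apply, stretchMap, Complex.mk_eq_add_mul_I]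
      simp only [id]
      ring)
  rw [coordYX_one_zero] at this
  simpa using this

lemma ae_distortion_stretchMap (hℓ : 0 < ℓ) (hu : AbsolutelyContinuousOnInterval u 0 ℓ) :
    ∀ᵐ z ∂volume.restrict (openRect ℓ), 0 < deriv u z.re →
      distortion (openRect ℓ) (stretchMap u) z = deriv u z.re + 1 / deriv u z.re := by
  have h1 := isWeakPartial_one_stretchMap hℓ hu
  have h2 := isWeakPartial_I_stretchMap hℓ hu
  filter_upwards [(isWeakPartial_weakPartial ⟨_, h1⟩).ae_eq (isOpen_openRect ℓ) h1,
    (isWeakPartial_weakPartial ⟨_, h2⟩).ae_eq (isOpen_openRect ℓ) h2] with z hz1 hz2 hp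
  have hJ : jacobian (openRect ℓ) (stretchMap u) z = deriv u z.re := by
    rw [jacobian, hz1, hz2]; simp
  have hN : normSqDeriv (openRect ℓ) (stretchMap u) z = deriv u z.re ^ 2 + 1 := by
    rw [normSqDeriv, hz1, hz2]; simp
  rw [distortion, hJ, if_pos hp, hN]
  field_simp

end Stretch

/-! ### The pointwise inequality -/

lemma ConvexOn.add_deriv_mul_sub_le {S : Set ℝ} {φ : ℝ → ℝ} (hφ : ConvexOn ℝ S φ) {x y : ℝ}
    (hx : x ∈ S) (hy : y ∈ S) (hd : DifferentiableAt ℝ φ x) :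
    φ x + deriv φ x * (y - x) ≤ φ y := by
  rcases lt_trichotomy x y with h | rfl | h
  · have h1 := hφ.deriv_le_slope hx hy h hd
    rw [slope_def_field, le_div_iff₀ (by linarith)] at h1
    linarith
  · simp
  · have h1 := hφ.slope_le_deriv hy hx h hd
    rw [slope_def_field, div_le_iff₀ (by linarith)] at h1
    linarith

/-- The case of a stretching `p > 1`. With `A = (a² + b²) / J` and `B = (c² + d²) / J` the estimate
is the sum of `A B ≥ 1`, of the tangent inequality for `A + 1 / A` at `p`, and of
`A + J ≥ 2 a`. -/
lemma stretch_pointwise {a b c d p m : ℝ} (hp : 1 < p) (hm : 0 < m) (hJ : 0 < a * d - b * c) :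
    2 * (m * (1 - 1 / p ^ 2)) * max a 0 ≤
        m * ((a ^ 2 + b ^ 2 + (c ^ 2 + d ^ 2)) / (a * d - b * c) - (p + 1 / p))
          + m * (1 - 1 / p ^ 2) * ((a * d - b * c) + p) ∧
      (2 * (m * (1 - 1 / p ^ 2)) * max a 0 =
        m * ((a ^ 2 + b ^ 2 + (c ^ 2 + d ^ 2)) / (a * d - b * c) - (p + 1 / p))
          + m * (1 - 1 / p ^ 2) * ((a * d - b * c) + p) → a = p ∧ b = 0 ∧ c = 0 ∧ d = 1) := by
  set J := a * d - b * c with hJdef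
  set α := m * (1 - 1 / p ^ 2) with hα
  have hp0 : 0 < p := by linarith
  have hαpos : 0 < α := by
    refine mul_pos hm (sub_pos.2 ?_)
    rw [div_lt_one (by positivity)]
    nlinarith
  set X := a ^ 2 + b ^ 2 with hX
  set Y := c ^ 2 + d ^ 2 with hY
  have hXpos : 0 < X := by
    rcases (add_nonneg (sq_nonneg a) (sq_nonneg b) : 0 ≤ X).lt_or_eq with h | h
    · exact h
    · have ha : a = 0 := by nlinarith [sq_nonneg a, sq_nonneg b]
      have hb : b = 0 := by nlinarith [sq_nonneg a, sq_nonneg b]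
      rw [hJdef, ha, hb] at hJ
      simp at hJ
  -- The three nonnegative defects.
  have e : m * ((X + Y) / J - (p + 1 / p)) + α * (J + p) - 2 * α * max a 0
      = m * (X * Y - J ^ 2) / (J * X) + m * (X - p * J) ^ 2 / (X * J * p ^ 2)
        + α * ((J - max a 0) ^ 2 + (X - (max a 0) ^ 2)) / J := by
    rw [hα]
    field_simp
    ring
  have t1 : 0 ≤ X * Y - J ^ 2 := by
    have : X * Y - J ^ 2 = (a * c + b * d) ^ 2 := by rw [hX, hY, hJdef]; ring
    rw [this]; exact sq_nonneg _
  have t2 : (max a 0) ^ 2 ≤ a ^ 2 := by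
    rcases le_total a 0 with h | h
    · rw [max_eq_right h, zero_pow two_ne_zero]; exact sq_nonneg _
    · rw [max_eq_left h]
  have t3 : 0 ≤ X - (max a 0) ^ 2 := by rw [hX]; nlinarith [sq_nonneg b]
  have n1 : 0 ≤ m * (X * Y - J ^ 2) / (J * X) := by positivity
  have n2 : 0 ≤ m * (X - p * J) ^ 2 / (X * J * p ^ 2) := by positivity
  have n3 : 0 ≤ α * ((J - max a 0) ^ 2 + (X - (max a 0) ^ 2)) / J := by positivity
  refine ⟨by linarith, fun h => ?_⟩
  have z2 : m * (X - p * J) ^ 2 / (X * J * p ^ 2) = 0 := by linarith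
  have z3 : α * ((J - max a 0) ^ 2 + (X - (max a 0) ^ 2)) / J = 0 := by linarith
  have z1 : m * (X * Y - J ^ 2) / (J * X) = 0 := by linarith
  have w2 : X = p * J := by
    rw [div_eq_zero_iff] at z2
    rcases z2 with z2 | z2
    · have := (mul_eq_zero.1 z2).resolve_left hm.ne'
      exact sub_eq_zero.1 (pow_eq_zero_iff (two_ne_zero) |>.1 this)
    · exact absurd z2 (by positivity)
  have w1 : X * Y = J ^ 2 := by
    rw [div_eq_zero_iff] at z1
    rcases z1 with z1 | z1
    · exact sub_eq_zero.1 ((mul_eq_zero.1 z1).resolve_left hm.ne')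
    · exact absurd z1 (by positivity)
  have w3 : (J - max a 0) ^ 2 + (X - (max a 0) ^ 2) = 0 := by
    rw [div_eq_zero_iff] at z3
    rcases z3 with z3 | z3
    · exact (mul_eq_zero.1 z3).resolve_left hαpos.ne'
    · exact absurd z3 (by positivity)
  have w4 : J = max a 0 := by
    have : (J - max a 0) ^ 2 = 0 := by linarith [sq_nonneg (J - max a 0)]
    exact sub_eq_zero.1 (pow_eq_zero_iff two_ne_zero |>.1 this)
  have ha : 0 < a := by
    rw [w4] at hJ
    exact (lt_max_iff.1 hJ).resolve_right (lt_irrefl _)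
  rw [max_eq_left ha.le] at w3 w4
  have hb : b = 0 := by
    have : b ^ 2 = 0 := by
      rw [w4, hX] at w3
      linear_combination w3
    exact pow_eq_zero_iff two_ne_zero |>.1 this
  have hap : a = p := by
    have : a * a = p * a := by rw [hX, hb, w4] at w2; linarith
    exact mul_right_cancel₀ ha.ne' this
  have hd : d = 1 := by
    have : a * d = a * 1 := by rw [hJdef, hb] at w4; linarith
    exact mul_left_cancel₀ ha.ne' this
  have hc : c = 0 := by
    have h1 : a ^ 2 * (c ^ 2 + 1) = a ^ 2 * 1 := by
      rw [hX, hY, hb, hd, w4] at w1; linarith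
    have h2 := mul_left_cancel₀ (by positivity : a ^ 2 ≠ 0) h1
    exact pow_eq_zero_iff two_ne_zero |>.1 (by linarith : c ^ 2 = 0)
  exact ⟨hap, hb, hc, hd⟩

/-- The case of a compression `p < 1`. With `A` and `B` as in the case of a stretching, the estimate
is the sum of `A B ≥ 1`, of the tangent inequality for `B + 1 / B` at `1 / p`, and of
`p² B + J ≥ 2 p d`. -/
lemma compression_pointwise {a b c d p m : ℝ} (hp0 : 0 < p) (hp : p < 1) (hm : 0 < m)
    (hJ : 0 < a * d - b * c) :
    2 * (m * (1 / p ^ 2 - 1)) * (p * max d 0) ≤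
        m * ((a ^ 2 + b ^ 2 + (c ^ 2 + d ^ 2)) / (a * d - b * c) - (p + 1 / p))
          + m * (1 / p ^ 2 - 1) * ((a * d - b * c) + p) ∧
      (2 * (m * (1 / p ^ 2 - 1)) * (p * max d 0) =
        m * ((a ^ 2 + b ^ 2 + (c ^ 2 + d ^ 2)) / (a * d - b * c) - (p + 1 / p))
          + m * (1 / p ^ 2 - 1) * ((a * d - b * c) + p) → a = p ∧ b = 0 ∧ c = 0 ∧ d = 1) := by
  set J := a * d - b * c with hJdef
  set α := m * (1 / p ^ 2 - 1) with hα
  have hαpos : 0 < α := by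
    refine mul_pos hm (sub_pos.2 ?_)
    rw [one_lt_div (by positivity)]
    nlinarith
  set X := a ^ 2 + b ^ 2 with hX
  set Y := c ^ 2 + d ^ 2 with hY
  have hYpos : 0 < Y := by
    rcases (add_nonneg (sq_nonneg c) (sq_nonneg d) : 0 ≤ Y).lt_or_eq with h | h
    · exact h
    · have hc : c = 0 := by nlinarith [sq_nonneg c, sq_nonneg d]
      have hd : d = 0 := by nlinarith [sq_nonneg c, sq_nonneg d]
      rw [hJdef, hc, hd] at hJ
      simp at hJ
  -- The three nonnegative defects.
  have e : m * ((X + Y) / J - (p + 1 / p)) + α * (J + p) - 2 * α * (p * max d 0)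
      = m * (X * Y - J ^ 2) / (J * Y) + m * (p * Y - J) ^ 2 / (Y * J)
        + α * ((J - p * max d 0) ^ 2 + p ^ 2 * (Y - (max d 0) ^ 2)) / J := by
    rw [hα]
    field_simp
    ring
  have t1 : 0 ≤ X * Y - J ^ 2 := by
    have : X * Y - J ^ 2 = (a * c + b * d) ^ 2 := by rw [hX, hY, hJdef]; ring
    rw [this]; exact sq_nonneg _
  have t2 : (max d 0) ^ 2 ≤ d ^ 2 := by
    rcases le_total d 0 with h | h
    · rw [max_eq_right h, zero_pow two_ne_zero]; exact sq_nonneg _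
    · rw [max_eq_left h]
  have t3 : 0 ≤ Y - (max d 0) ^ 2 := by rw [hY]; nlinarith [sq_nonneg c]
  have n1 : 0 ≤ m * (X * Y - J ^ 2) / (J * Y) := by positivity
  have n2 : 0 ≤ m * (p * Y - J) ^ 2 / (Y * J) := by positivity
  have n3 : 0 ≤ α * ((J - p * max d 0) ^ 2 + p ^ 2 * (Y - (max d 0) ^ 2)) / J := by positivity
  refine ⟨by linarith, fun h => ?_⟩
  have z2 : m * (p * Y - J) ^ 2 / (Y * J) = 0 := by linarith
  have z3 : α * ((J - p * max d 0) ^ 2 + p ^ 2 * (Y - (max d 0) ^ 2)) / J = 0 := by linarith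
  have z1 : m * (X * Y - J ^ 2) / (J * Y) = 0 := by linarith
  have w2 : p * Y = J := by
    rw [div_eq_zero_iff] at z2
    rcases z2 with z2 | z2
    · have := (mul_eq_zero.1 z2).resolve_left hm.ne'
      exact sub_eq_zero.1 (pow_eq_zero_iff (two_ne_zero) |>.1 this)
    · exact absurd z2 (by positivity)
  have w1 : X * Y = J ^ 2 := by
    rw [div_eq_zero_iff] at z1
    rcases z1 with z1 | z1
    · exact sub_eq_zero.1 ((mul_eq_zero.1 z1).resolve_left hm.ne')
    · exact absurd z1 (by positivity)
  have w3 : (J - p * max d 0) ^ 2 + p ^ 2 * (Y - (max d 0) ^ 2) = 0 := by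
    rw [div_eq_zero_iff] at z3
    rcases z3 with z3 | z3
    · exact (mul_eq_zero.1 z3).resolve_left hαpos.ne'
    · exact absurd z3 (by positivity)
  have t4 : 0 ≤ p ^ 2 * (Y - (max d 0) ^ 2) := by positivity
  have w4 : J = p * max d 0 := by
    have : (J - p * max d 0) ^ 2 = 0 := by linarith [sq_nonneg (J - p * max d 0)]
    exact sub_eq_zero.1 (pow_eq_zero_iff two_ne_zero |>.1 this)
  have hd0 : 0 < d := by
    rw [w4] at hJ
    exact (lt_max_iff.1 (pos_of_mul_pos_right hJ hp0.le)).resolve_right (lt_irrefl _)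
  rw [max_eq_left hd0.le] at w3 w4
  have hc : c = 0 := by
    have h1 : p ^ 2 * c ^ 2 = 0 := by
      rw [hY, w4] at w3
      linear_combination w3
    have := (mul_eq_zero.1 h1).resolve_left (by positivity)
    exact pow_eq_zero_iff two_ne_zero |>.1 this
  have hd : d = 1 := by
    have h1 : p * (d * d) = p * (d * 1) := by
      rw [hY, hc, w4] at w2; linarith
    exact mul_left_cancel₀ hd0.ne' (mul_left_cancel₀ hp0.ne' h1)
  have hap : a = p := by
    rw [hJdef, hc, hd] at w4; linarith
  have hb : b = 0 := by
    have h1 : b ^ 2 = 0 := by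
      rw [w4, hX, hY, hc, hd, hap] at w1; linarith
    exact pow_eq_zero_iff two_ne_zero |>.1 h1
  exact ⟨hap, hb, hc, hd⟩

open Classical in
/-- The pointwise inequality behind the theorem, for a differential with columns `(a, b)` and
`(c, d)` that vanishes when its Jacobian does. Equality holds for the differential of the
stretch map only. -/
lemma distortion_pointwise {a b c d p m α K : ℝ} (hp : 0 < p) (hm : 0 < m) (hα : α ≠ 0)
    (hmα : m * (1 - 1 / p ^ 2) = α) (hJ : 0 ≤ a * d - b * c)
    (h0 : a * d - b * c = 0 → a = 0 ∧ d = 0)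
    (hK : K = if 0 < a * d - b * c then
      (a ^ 2 + b ^ 2 + (c ^ 2 + d ^ 2)) / (a * d - b * c) else 2) :
    2 * |α| * (if 0 < α then max a 0 else p * max d 0)
        ≤ m * (K - (p + 1 / p)) + |α| * ((a * d - b * c) + p) ∧
      (2 * |α| * (if 0 < α then max a 0 else p * max d 0)
        = m * (K - (p + 1 / p)) + |α| * ((a * d - b * c) + p) → a = p ∧ b = 0 ∧ c = 0 ∧ d = 1) := by
  by_cases hαpos : 0 < α
  · have hp1 : 1 < p := by
      have h1 : 0 < 1 - 1 / p ^ 2 := by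
        rw [← hmα] at hαpos
        exact pos_of_mul_pos_right hαpos hm.le
      rw [sub_pos, div_lt_one (by positivity)] at h1
      exact (one_lt_sq_iff₀ hp.le).1 h1
    rw [abs_of_pos hαpos, if_pos hαpos]
    rcases hJ.lt_or_eq with h | h
    · rw [if_pos h] at hK
      rw [← hmα, hK]
      exact stretch_pointwise hp1 hm h
    · obtain ⟨rfl, -⟩ := h0 h.symm
      rw [← h, if_neg (lt_irrefl _)] at hK
      have key : 2 * α * max (0 : ℝ) 0 < m * (K - (p + 1 / p)) + α * (0 + p) := by
        have e : m * (2 - (p + 1 / p)) + m * (1 - 1 / p ^ 2) * (0 + p) = 2 * m * (p - 1) / p := by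
          field_simp
          ring
        rw [hK, ← hmα, e, max_self, mul_zero]
        have := sub_pos.2 hp1
        positivity
      rw [← h]
      exact ⟨key.le, fun h => absurd h key.ne⟩
  · have hαneg : α < 0 := lt_of_le_of_ne (not_lt.1 hαpos) hα
    have hp1 : p < 1 := by
      have h1 : 1 - 1 / p ^ 2 < 0 := by
        rw [← hmα] at hαneg
        exact neg_of_mul_neg_right hαneg hm.le
      rw [sub_neg, one_lt_div (by positivity)] at h1
      exact (sq_lt_one_iff₀ hp.le).1 h1
    have hmα' : -α = m * (1 / p ^ 2 - 1) := by rw [← hmα]; ring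
    rw [abs_of_neg hαneg, if_neg hαpos]
    rcases hJ.lt_or_eq with h | h
    · rw [if_pos h] at hK
      rw [hmα', hK]
      exact compression_pointwise hp hp1 hm h
    · obtain ⟨-, rfl⟩ := h0 h.symm
      rw [← h, if_neg (lt_irrefl _)] at hK
      have key : 2 * (-α) * (p * max (0 : ℝ) 0) < m * (K - (p + 1 / p)) + -α * (0 + p) := by
        have e : m * (2 - (p + 1 / p)) + m * (1 / p ^ 2 - 1) * (0 + p) = 2 * m * (1 - p) := by
          field_simp
          ring
        rw [hK, hmα', e, max_self, mul_zero, mul_zero]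
        have := sub_pos.2 hp1
        positivity
      rw [← h]
      exact ⟨key.le, fun h => absurd h key.ne⟩

/-! ### Integral estimates -/

lemma quasiMeasurePreserving_re (ℓ : ℝ) : Measure.QuasiMeasurePreserving Complex.re
    (volume.restrict (openRect ℓ)) (volume.restrict (Ioo 0 ℓ)) := by
  refine ⟨Complex.measurable_re, ?_⟩
  have h := (measurePreserving_restrict_prod measurePreserving_coordXY (coordXY_preimage ℓ)).map_eq
  rw [← h, Measure.map_map Complex.measurable_re coordXY.continuous.measurable]
  have : Complex.re ∘ coordXY = Prod.fst := by
    funext p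
    simp [coordXY_apply]
  rw [this]
  exact Measure.quasiMeasurePreserving_fst.absolutelyContinuous

lemma lintegral_deriv_re {ℓ : ℝ} {u : ℝ → ℝ} (hℓ : 0 < ℓ)
    (hu : AbsolutelyContinuousOnInterval u 0 ℓ)
    (hpos : ∀ᵐ x ∂volume.restrict (Ioo 0 ℓ), 0 < deriv u x) :
    ∫⁻ x in Ioo 0 ℓ, ENNReal.ofReal (deriv u x) = ENNReal.ofReal (u ℓ - u 0) := by
  rw [← hu.integral_deriv_eq_sub, intervalIntegral.integral_of_le hℓ.le,
    integral_Ioc_eq_integral_Ioo, ofReal_integral_eq_lintegral_ofReal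
      (hu.intervalIntegrable_deriv.1.mono_set Ioo_subset_Ioc_self)
      (hpos.mono fun x hx => hx.le)]

lemma lintegral_openRect_deriv_re {ℓ : ℝ} {u : ℝ → ℝ} (hℓ : 0 < ℓ)
    (hu : AbsolutelyContinuousOnInterval u 0 ℓ)
    (hpos : ∀ᵐ x ∂volume.restrict (Ioo 0 ℓ), 0 < deriv u x) :
    ∫⁻ z in openRect ℓ, ENNReal.ofReal (deriv u z.re) = ENNReal.ofReal (u ℓ - u 0) := by
  have hmp := measurePreserving_restrict_prod measurePreserving_coordXY (coordXY_preimage ℓ)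
  rw [← hmp.lintegral_comp_emb coordXY.toHomeomorph.measurableEmbedding]
  simp only [coordXY_apply]
  rw [lintegral_prod (fun p : ℝ × ℝ => ENNReal.ofReal (deriv u p.1))
    ((measurable_deriv u).comp measurable_fst).ennreal_ofReal.aemeasurable]
  simp [lintegral_deriv_re hℓ hu hpos]

/-- Composition with the nearest point projection extends a continuous map of the closed rectangle
to the plane. -/
lemma exists_continuous_eqOn_closedRect {ℓ : ℝ} (hℓ : 0 < ℓ) {f : ℂ → ℂ}
    (hf : ContinuousOn f (closedRect ℓ)) : ∃ f', Continuous f' ∧ EqOn f f' (closedRect ℓ) := by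
  set π : ℂ → ℂ := fun z => ⟨max 0 (min ℓ z.re), max 0 (min 1 z.im)⟩ with hπ
  have hπc : Continuous π := by
    have : π = fun z =>
        ((max 0 (min ℓ z.re) : ℝ) : ℂ) + ((max 0 (min 1 z.im) : ℝ) : ℂ) * Complex.I := by
      funext z
      exact Complex.mk_eq_add_mul_I _ _
    rw [this]
    have := Complex.continuous_re
    have := Complex.continuous_im
    fun_prop
  have hπm : ∀ z, π z ∈ closedRect ℓ := fun z =>
    ⟨⟨le_max_left _ _, max_le hℓ.le (min_le_left _ _)⟩,
      ⟨le_max_left _ _, max_le zero_le_one (min_le_left _ _)⟩⟩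
  refine ⟨f ∘ π, hf.comp_continuous hπc hπm, fun z hz => ?_⟩
  have : π z = z := by
    apply Complex.ext
    · simp only [hπ, min_eq_right hz.1.2, max_eq_right hz.1.1]
    · simp only [hπ, min_eq_right hz.2.2, max_eq_right hz.2.1]
  simp only [Function.comp_apply, this]

lemma openRect_subset_closedRect (ℓ : ℝ) : openRect ℓ ⊆ closedRect ℓ :=
  fun _ hz => ⟨Ioo_subset_Icc_self hz.1, Ioo_subset_Icc_self hz.2⟩

section Rectangle

variable {ℓ : ℝ} {f' gx gy : ℂ → ℂ}

lemma lintegral_weakJacobian_le {L : ℝ} (hf' : Continuous f')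
    (hmaps : MapsTo f' (openRect ℓ) (closedRect L)) (hinj : InjOn f' (openRect ℓ))
    (hgx : AEStronglyMeasurable gx (volume.restrict (openRect ℓ)))
    (hgy : AEStronglyMeasurable gy (volume.restrict (openRect ℓ)))
    (h₁ : HasWeakDerivFst ℓ 1 (fun p => f' (coordXY p)) (fun p => gx (coordXY p)))
    (h₂ : HasWeakDerivFst 1 ℓ (fun p => f' (coordYX p)) (fun p => gy (coordYX p))) :
    ∫⁻ z in openRect ℓ, ENNReal.ofReal ((gx z).re * (gy z).im - (gx z).im * (gy z).re)
      ≤ ENNReal.ofReal L := by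
  have d₁ := h₁.ae_lineDeriv_eq measurePreserving_coordXY (coordXY_preimage ℓ) hf' hgx
  have d₂ := h₂.ae_lineDeriv_eq measurePreserving_coordYX (coordYX_preimage ℓ) hf' hgy
  rw [coordXY_one_zero] at d₁
  rw [coordYX_one_zero] at d₂
  have key := lintegral_abs_jacobian_le hf' (isOpen_openRect ℓ).measurableSet
    (by rw [volume_openRect]; exact ENNReal.ofReal_ne_top) hinj
    (d₁.mono fun z hz => hz.1) (d₂.mono fun z hz => hz.1)
  calc _ ≤ _ := lintegral_mono_ae ?_
    _ ≤ _ := key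
    _ ≤ volume (closedRect L) := measure_mono hmaps.image_subset
    _ = _ := volume_closedRect L
  filter_upwards [d₁, d₂] with z h1 h2
  rw [h1.2, h2.2]
  exact ENNReal.ofReal_le_ofReal (le_abs_self _)

/-- If a linear functional of the derivative along the first axis is that of a function `v` of one
variable, and the boundary values at the left side agree, then the functional of the map is `v`. -/
lemma HasWeakDerivFst.eq_of_ae_eq_deriv {A B : ℝ} {F G : ℝ × ℝ → ℂ} (h : HasWeakDerivFst A B F G)
    (hA : 0 < A) (hB : 0 < B) (κ : ℂ →L[ℝ] ℝ) {v : ℝ → ℝ}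
    (hv : AbsolutelyContinuousOnInterval v 0 A)
    (hG : ∀ᵐ y ∂volume.restrict (Ioo 0 B), ∀ᵐ x ∂volume.restrict (Ioo 0 A),
      κ (G (x, y)) = deriv v x)
    (h0 : ∀ y ∈ Icc 0 B, κ (F (0, y)) = v 0) {x y : ℝ} (hx : x ∈ Icc 0 A) (hy : y ∈ Icc 0 B) :
    κ (F (x, y)) = v x := by
  have hFc := h.continuous
  have hvc : ContinuousOn v (Icc 0 A) := by
    have := hv.continuousOn
    rwa [uIcc_of_le hA.le] at this
  have key : ∀ᵐ y ∂volume.restrict (Icc 0 B), κ (F (x, y)) = v x := by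
    rw [← restrict_Ioo_eq_restrict_Icc]
    filter_upwards [h.ae_sub_eq_integral, hG, ae_restrict_mem measurableSet_Ioo]
      with y hy1 hy2 hyB
    have step : ∀ r s, 0 < r → r ≤ s → s < A → κ (F (s, y)) - κ (F (r, y)) = v s - v r := by
      intro r s hr hrs hs
      obtain ⟨hi, he⟩ := hy1 r s hr hrs hs
      have hsub : Ioc r s ⊆ Ioo 0 A := fun t ht => ⟨hr.trans ht.1, ht.2.trans_lt hs⟩
      have hsub' : uIcc r s ⊆ uIcc 0 A := by
        rw [uIcc_of_le hrs, uIcc_of_le hA.le]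
        exact Icc_subset_Icc hr.le hs.le
      rw [← map_sub, he, intervalIntegral.integral_of_le hrs, ← κ.integral_comp_comm hi.1,
        ← (hv.mono hsub').integral_deriv_eq_sub, intervalIntegral.integral_of_le hrs]
      exact integral_congr_ae (ae_restrict_of_ae_restrict_of_subset hsub hy2)
    set c := κ (F (A / 2, y)) - v (A / 2) with hc
    have hFy : Continuous fun x => κ (F (x, y)) := by fun_prop
    have hconst : EqOn (fun x => κ (F (x, y)) - v x) (fun _ => c) (Icc 0 A) := by
      refine EqOn.of_subset_closure (s := Ioo 0 A) ?_ (hFy.continuousOn.sub hvc)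
        continuousOn_const Ioo_subset_Icc_self (closure_Ioo hA.ne).ge
      intro t ht
      rcases le_total t (A / 2) with h | h
      · have := step t (A / 2) ht.1 h (by linarith)
        simp only [hc]
        linarith
      · have := step (A / 2) t (by linarith) h ht.2
        simp only [hc]
        linarith
    have e0 := hconst ⟨le_rfl, hA.le⟩
    have e1 := hconst hx
    simp only [h0 y (Ioo_subset_Icc_self hyB)] at e0 e1
    linarith
  have hFx : Continuous fun y => κ (F (x, y)) := by fun_prop
  exact Measure.eqOn_of_ae_eq (f := fun y => κ (F (x, y))) (g := fun _ => v x) key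
    hFx.continuousOn continuousOn_const (closure_interior_Icc hB.ne).ge hy

end Rectangle

lemma two_le_distortion (U : Set ℂ) (f : ℂ → ℂ) (z : ℂ) : 2 ≤ distortion U f z := by
  rw [distortion]
  split_ifs with h
  · rw [le_div_iff₀ h, normSqDeriv, jacobian, ← Complex.normSq_eq_norm_sq,
      ← Complex.normSq_eq_norm_sq, Complex.normSq_apply, Complex.normSq_apply]
    set a := weakPartial U 1 f z
    set b := weakPartial U Complex.I f z
    linarith [sq_nonneg (a.re - b.im), sq_nonneg (a.im + b.re)]
  · exact le_rfl

open Classical in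
lemma aemeasurable_distortion {U : Set ℂ} {f : ℂ → ℂ}
    (hgx : AEMeasurable (weakPartial U 1 f) (volume.restrict U))
    (hgy : AEMeasurable (weakPartial U Complex.I f) (volume.restrict U)) :
    AEMeasurable (distortion U f) (volume.restrict U) := by
  have hJ : AEMeasurable (jacobian U f) (volume.restrict U) :=
    ((Complex.measurable_re.comp_aemeasurable hgx).mul
      (Complex.measurable_im.comp_aemeasurable hgy)).sub
      ((Complex.measurable_im.comp_aemeasurable hgx).mul
        (Complex.measurable_re.comp_aemeasurable hgy))
  have hN : AEMeasurable (normSqDeriv U f) (volume.restrict U) :=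
    (hgx.norm.pow_const 2).add (hgy.norm.pow_const 2)
  have hk : Measurable fun q : ℝ × ℝ => if 0 < q.1 then q.2 / q.1 else 2 :=
    Measurable.ite (measurableSet_lt measurable_const measurable_fst)
      (measurable_snd.div measurable_fst) measurable_const
  exact hk.comp_aemeasurable (hJ.prodMk hN)

lemma aemeasurable_comp_distortion {U : Set ℂ} {f : ℂ → ℂ} {φ : ℝ → ℝ}
    (hφ : MonotoneOn φ (Ici 1))
    (hK : AEMeasurable (distortion U f) (volume.restrict U)) :
    AEMeasurable (fun z => φ (distortion U f z)) (volume.restrict U) := by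
  have hm : Monotone fun t => φ (max 1 t) := fun s t hst =>
    hφ (mem_Ici.2 (le_max_left _ _)) (mem_Ici.2 (le_max_left _ _)) (max_le_max le_rfl hst)
  refine (hm.measurable.comp_aemeasurable hK).congr (Eventually.of_forall fun z => ?_)
  simp only [Function.comp_apply]
  rw [max_eq_right (one_le_two.trans (two_le_distortion U f z))]

/-- The pointwise inequality between the two energy densities: the tangent inequality for `φ` at the
distortion of the stretch map turns the differential equation into the hypothesis on `α` of
`distortion_pointwise`. -/
lemma energyDensity_pointwise {U : Set ℂ} {f : ℂ → ℂ} {φ : ℝ → ℝ} {z : ℂ} {p c α : ℝ}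
    (hφ_nonneg : ∀ t ∈ Ici (1 : ℝ), 0 ≤ φ t)
    (hφ_convex : ConvexOn ℝ (Ici 1) φ) (hφ_mono : MonotoneOn φ (Ici 1)) (hα : α ≠ 0)
    (hp : 0 < p) (hc : 0 < c) (hode : c * (1 - 1 / p ^ 2) * deriv φ (p + 1 / p) = α)
    (hJ : 0 ≤ jacobian U f z) {k : ℝ} (hK : normSqDeriv U f z ≤ k * jacobian U f z)
    {ρ : ℝ} (hρ : ρ = if 0 < α then max (weakPartial U 1 f z).re 0
      else p * max (weakPartial U Complex.I f z).im 0) :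
    ENNReal.ofReal (φ (p + 1 / p) * c) + ENNReal.ofReal (2 * |α| * ρ)
        ≤ ENNReal.ofReal (φ (distortion U f z) * c) + ENNReal.ofReal (|α| * (jacobian U f z + p)) ∧
      (ENNReal.ofReal (φ (p + 1 / p) * c) + ENNReal.ofReal (2 * |α| * ρ)
        = ENNReal.ofReal (φ (distortion U f z) * c) + ENNReal.ofReal (|α| * (jacobian U f z + p)) →
        weakPartial U 1 f z = p ∧ weakPartial U Complex.I f z = Complex.I) := by
  set K := distortion U f z with hKdef
  set a := weakPartial U 1 f z with ha
  set b := weakPartial U Complex.I f z with hb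
  have hK2 : 2 ≤ K := two_le_distortion U f z
  have hK0 : 2 ≤ p + 1 / p := by
    have : p + 1 / p - 2 = (p - 1) ^ 2 / p := by field_simp; ring
    have : 0 ≤ (p - 1) ^ 2 / p := by positivity
    linarith
  have hφ'ne : deriv φ (p + 1 / p) ≠ 0 := by
    rintro h
    rw [h, mul_zero] at hode
    exact hα hode.symm
  have hdiff := differentiableAt_of_deriv_ne_zero hφ'ne
  have m1 : (1 : ℝ) ∈ Ici (1 : ℝ) := self_mem_Ici
  have mK0 : p + 1 / p ∈ Ici (1 : ℝ) := by rw [mem_Ici]; linarith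
  have mK : K ∈ Ici (1 : ℝ) := by rw [mem_Ici]; linarith
  have hφ'pos : 0 < deriv φ (p + 1 / p) := by
    refine lt_of_le_of_ne ?_ hφ'ne.symm
    have h1 := hφ_convex.add_deriv_mul_sub_le mK0 m1 hdiff
    have h2 := hφ_mono m1 mK0 mK0
    by_contra! h
    nlinarith
  have htan := hφ_convex.add_deriv_mul_sub_le mK0 mK hdiff
  have hJe : jacobian U f z = a.re * b.im - a.im * b.re := rfl
  have hNe : normSqDeriv U f z = a.re ^ 2 + a.im ^ 2 + (b.re ^ 2 + b.im ^ 2) := by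
    rw [normSqDeriv, ← Complex.normSq_eq_norm_sq, ← Complex.normSq_eq_norm_sq,
      Complex.normSq_apply, Complex.normSq_apply]
    ring
  have h0 : a.re * b.im - a.im * b.re = 0 → a.re = 0 ∧ b.im = 0 := by
    intro h
    rw [hNe, hJe, h, mul_zero] at hK
    have s1 := sq_nonneg a.re
    have s2 := sq_nonneg a.im
    have s3 := sq_nonneg b.re
    have s4 := sq_nonneg b.im
    exact ⟨(pow_eq_zero_iff two_ne_zero).1 (by linarith),
      (pow_eq_zero_iff two_ne_zero).1 (by linarith)⟩
  classical
  obtain ⟨P1, P2⟩ := distortion_pointwise (a := a.re) (b := a.im) (c := b.re) (d := b.im)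
    (m := c * deriv φ (p + 1 / p)) (K := K) hp (mul_pos hc hφ'pos) hα
    (by rw [← hode]; ring) (by rw [← hJe]; exact hJ) h0
    (by rw [hKdef, distortion, hNe, hJe])
  have hρ' : ρ = if 0 < α then max a.re 0 else p * max b.im 0 := by rw [hρ]
  have hρ0 : 0 ≤ ρ := by
    rw [hρ']
    split_ifs
    · exact le_max_right _ _
    · exact mul_nonneg hp.le (le_max_right _ _)
  have hρ'' : (if 0 < α then max a.re 0 else p * max b.im 0) = ρ := hρ'.symm
  rw [← hJe] at P1 P2
  have P1' : 2 * |α| * ρ ≤ c * deriv φ (p + 1 / p) * (K - (p + 1 / p))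
      + |α| * (jacobian U f z + p) := by
    rw [hρ']; convert P1
  have P2' : 2 * |α| * ρ = c * deriv φ (p + 1 / p) * (K - (p + 1 / p))
      + |α| * (jacobian U f z + p) → a.re = p ∧ a.im = 0 ∧ b.re = 0 ∧ b.im = 1 := by
    intro h
    refine P2 (Eq.trans ?_ h)
    rw [hρ']
  have htan' : φ (p + 1 / p) * c + c * deriv φ (p + 1 / p) * (K - (p + 1 / p)) ≤ φ K * c := by
    nlinarith
  have q1 : 0 ≤ φ (p + 1 / p) * c := mul_nonneg (hφ_nonneg _ mK0) hc.le
  have q2 : 0 ≤ φ K * c := mul_nonneg (hφ_nonneg _ mK) hc.le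
  have q3 : 0 ≤ 2 * |α| * ρ := by positivity
  have q4 : 0 ≤ |α| * (jacobian U f z + p) := by positivity
  rw [← ENNReal.ofReal_add q1 q3, ← ENNReal.ofReal_add q2 q4]
  refine ⟨ENNReal.ofReal_le_ofReal (by linarith), fun h => ?_⟩
  rw [ENNReal.ofReal_eq_ofReal_iff (by positivity) (by positivity)] at h
  obtain ⟨r1, r2, r3, r4⟩ := P2' (by linarith)
  exact ⟨Complex.ext (by simp [r1]) (by simp [r2]), Complex.ext (by simp [r3]) (by simp [r4])⟩

/-! ### The Grötzsch problem -/

theorem mainTheorem1 (ℓ L L₀ α : ℝ) (w φ u : ℝ → ℝ)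
    (hℓ : 0 < ℓ) (hL : 0 < L)
    (hw_meas : AEMeasurable w (volume.restrict (Ioo 0 ℓ)))
    (hw_pos : ∀ x ∈ Ioo 0 ℓ, 0 < w x)
    (hφ_nonneg : ∀ t ∈ Ici (1 : ℝ), 0 ≤ φ t)
    (hφ_convex : ConvexOn ℝ (Ici 1) φ)
    (hφ_mono : MonotoneOn φ (Ici 1))
    (hu_maps : MapsTo u (Icc 0 ℓ) (Icc 0 L))
    (hu_zero : u 0 = 0) (hu_end : u ℓ = L₀)
    (hα : α ≠ 0)
    (hu_ode : IsODESolution ℓ φ w α u)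
    (hL₀ : L₀ ≤ L) (hα_neg : α < 0 → L₀ = L)
    (f : ℂ → ℂ)
    (hf_homeo : IsHomeoOnto f (closedRect ℓ) (closedRect L))
    (hf_dist : HasFiniteDistortion (openRect ℓ) f)
    (hf_bdry : GrotzschBoundary ℓ L f) :
    distortionEnergy ℓ φ w (stretchMap u) ≤ distortionEnergy ℓ φ w f ∧
      (distortionEnergy ℓ φ w (stretchMap u) < ⊤ →
        (distortionEnergy ℓ φ w f = distortionEnergy ℓ φ w (stretchMap u) ↔
          EqOn f (stretchMap u) (closedRect ℓ)) ∧
        (L₀ < L → distortionEnergy ℓ φ w (stretchMap u) < distortionEnergy ℓ φ w f)) := by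
  obtain ⟨hu, hode⟩ := hu_ode
  set Ω := openRect ℓ with hΩ
  have hΩo : IsOpen Ω := isOpen_openRect ℓ
  have hpos : ∀ᵐ x ∂volume.restrict (Ioo 0 ℓ), 0 < deriv u x := hode.mono fun x hx => hx.1
  have hαpos : 0 < |α| := abs_pos.2 hα
  have hL₀0 : 0 ≤ L₀ := by
    rw [← hu_end]; exact (hu_maps ⟨hℓ.le, le_rfl⟩).1
  -- The continuous extension of `f` and its weak derivatives.
  obtain ⟨h, hh⟩ := hf_homeo
  have hf_cont : ContinuousOn f (closedRect ℓ) := by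
    rw [continuousOn_iff_continuous_domRestrict]
    exact (continuous_subtype_val.comp h.continuous).congr hh
  have hf_maps : MapsTo f (closedRect ℓ) (closedRect L) := fun z hz => by
    rw [← hh ⟨z, hz⟩]; exact (h ⟨z, hz⟩).2
  have hf_inj : InjOn f (closedRect ℓ) := fun z hz w hw hzw => by
    have : h ⟨z, hz⟩ = h ⟨w, hw⟩ := Subtype.ext ((hh ⟨z, hz⟩).trans (hzw.trans (hh ⟨w, hw⟩).symm))
    exact congrArg Subtype.val (h.injective this)
  obtain ⟨f', hf'c, hff'⟩ := exists_continuous_eqOn_closedRect hℓ hf_cont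
  have hsub := openRect_subset_closedRect ℓ
  have hff'Ω : EqOn f f' Ω := hff'.mono hsub
  obtain ⟨⟨hex, hey⟩, hJ, k, hk⟩ := hf_dist
  set gx := weakPartial Ω 1 f with hgx
  set gy := weakPartial Ω Complex.I f with hgy
  have hWx : IsWeakPartial Ω 1 f gx := isWeakPartial_weakPartial hex
  have hWy : IsWeakPartial Ω Complex.I f gy := isWeakPartial_weakPartial hey
  have hmx : AEStronglyMeasurable gx (volume.restrict Ω) := hWx.2.1.aestronglyMeasurable
  have hmy : AEStronglyMeasurable gy (volume.restrict Ω) := hWy.2.1.aestronglyMeasurable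
  have hHx : HasWeakDerivFst ℓ 1 (fun p => f' (coordXY p)) (fun p => gx (coordXY p)) :=
    IsWeakPartial.hasWeakDerivFst measurePreserving_coordXY (coordXY_preimage ℓ) hf'c hff'Ω
      (by rw [coordXY_one_zero]; exact hWx)
  have hHy : HasWeakDerivFst 1 ℓ (fun p => f' (coordYX p)) (fun p => gy (coordYX p)) :=
    IsWeakPartial.hasWeakDerivFst measurePreserving_coordYX (coordYX_preimage ℓ) hf'c hff'Ω
      (by rw [coordYX_one_zero]; exact hWy)
  have hbx0 : ∀ y ∈ Icc (0 : ℝ) 1, (f' (coordXY (0, y))).re = 0 := fun y hy => by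
    rw [coordXY_apply, ← hff' ⟨⟨le_rfl, hℓ.le⟩, hy⟩]; exact (hf_bdry.1 y hy).1
  have hbxℓ : ∀ y ∈ Icc (0 : ℝ) 1, (f' (coordXY (ℓ, y))).re = L := fun y hy => by
    rw [coordXY_apply, ← hff' ⟨⟨hℓ.le, le_rfl⟩, hy⟩]; exact (hf_bdry.1 y hy).2
  have hby0 : ∀ x ∈ Icc (0 : ℝ) ℓ, (f' (coordYX (0, x))).im = 0 := fun x hx => by
    rw [coordYX_apply, ← hff' ⟨hx, ⟨le_rfl, zero_le_one⟩⟩]; exact (hf_bdry.2 x hx).1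
  have hby1 : ∀ x ∈ Icc (0 : ℝ) ℓ, (f' (coordYX (1, x))).im = 1 := fun x hx => by
    rw [coordYX_apply, ← hff' ⟨hx, ⟨zero_le_one, le_rfl⟩⟩]; exact (hf_bdry.2 x hx).2
  -- The four terms of the pointwise inequality and their integrals.
  classical
  set ρ : ℂ → ℝ := fun z => if 0 < α then max (gx z).re 0 else deriv u z.re * max (gy z).im 0
    with hρ
  set S : ℂ → ℝ≥0∞ := fun z =>
    ENNReal.ofReal (φ (deriv u z.re + 1 / deriv u z.re) * w z.re) with hS
  set R : ℂ → ℝ≥0∞ := fun z => ENNReal.ofReal (2 * |α| * ρ z) with hR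
  set T : ℂ → ℝ≥0∞ := fun z => ENNReal.ofReal (φ (distortion Ω f z) * w z.re) with hT
  set Q : ℂ → ℝ≥0∞ := fun z => ENNReal.ofReal (|α| * (jacobian Ω f z + deriv u z.re)) with hQ
  have hre := quasiMeasurePreserving_re ℓ
  have hodeΩ := hre.ae hode
  have hposΩ := hre.ae hpos
  have hE₀ : distortionEnergy ℓ φ w (stretchMap u) = ∫⁻ z in Ω, S z := by
    refine lintegral_congr_ae ?_
    filter_upwards [ae_distortion_stretchMap hℓ hu, hposΩ] with z hz hz'
    rw [hz hz', hS]
  have hE : distortionEnergy ℓ φ w f = ∫⁻ z in Ω, T z := rfl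
  have hpt : ∀ᵐ z ∂volume.restrict Ω, S z + R z ≤ T z + Q z ∧
      (S z + R z = T z + Q z → gx z = (deriv u z.re : ℝ) ∧ gy z = Complex.I) := by
    filter_upwards [hodeΩ, hJ, hk, ae_restrict_mem hΩo.measurableSet] with z hz hJz hkz hzΩ
    exact energyDensity_pointwise hφ_nonneg hφ_convex hφ_mono hα hz.1 (hw_pos _ hzΩ.1) hz.2 hJz hkz
      rfl
  have hpint : ∫⁻ z in Ω, ENNReal.ofReal (deriv u z.re) = ENNReal.ofReal L₀ := by
    rw [lintegral_openRect_deriv_re hℓ hu hpos, hu_end, hu_zero, sub_zero]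
  have hRint : ENNReal.ofReal (2 * |α| * L) ≤ ∫⁻ z in Ω, R z := by
    have h2α : (0 : ℝ) ≤ 2 * |α| := by positivity
    have e : ∀ z, R z = ENNReal.ofReal (2 * |α|) * ENNReal.ofReal (ρ z) := fun z =>
      ENNReal.ofReal_mul h2α
    simp only [e]
    rw [lintegral_const_mul' _ _ ENNReal.ofReal_ne_top, ENNReal.ofReal_mul h2α]
    gcongr
    by_cases hα0 : 0 < α
    · have key := hHx.lintegral_mul_le measurePreserving_coordXY (coordXY_preimage ℓ) hℓ hmx
        Complex.reCLM (wt := fun _ => 1) aemeasurable_const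
      calc ENNReal.ofReal L = ∫⁻ y in Ioo (0 : ℝ) 1, ENNReal.ofReal L := by simp
        _ = _ := setLIntegral_congr_fun measurableSet_Ioo fun y hy => by
            have hy' := Ioo_subset_Icc_self hy
            simp only [Complex.reCLM_apply, hbx0 y hy', hbxℓ y hy', sub_zero, one_mul]
        _ ≤ _ := key
        _ ≤ _ := lintegral_mono fun z => by
            simp only [one_mul, Complex.reCLM_apply, hρ, if_pos hα0]
            exact ENNReal.ofReal_le_ofReal (le_max_left _ _)
    · have key := hHy.lintegral_mul_le measurePreserving_coordYX (coordYX_preimage ℓ) one_pos hmy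
        Complex.imCLM (wt := fun x => ENNReal.ofReal (deriv u x))
        (measurable_deriv u).ennreal_ofReal.aemeasurable
      have hLL : L₀ = L := hα_neg (lt_of_le_of_ne (not_lt.1 hα0) hα)
      calc ENNReal.ofReal L = ∫⁻ x in Ioo 0 ℓ, ENNReal.ofReal (deriv u x) := by
            rw [lintegral_deriv_re hℓ hu hpos, hu_end, hu_zero, sub_zero, hLL]
        _ = _ := setLIntegral_congr_fun measurableSet_Ioo fun x hx => by
            have hx' := Ioo_subset_Icc_self hx
            simp only [Complex.imCLM_apply, hby0 x hx', hby1 x hx', sub_zero, ENNReal.ofReal_one,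
              mul_one]
        _ ≤ _ := key
        _ ≤ _ := by
            refine lintegral_mono_ae ?_
            filter_upwards [hposΩ] with z hz
            simp only [coordYX_symm_snd, Complex.imCLM_apply, hρ, if_neg hα0]
            rw [ENNReal.ofReal_mul hz.le]
            gcongr
            exact le_max_left _ _
  have hJint : ∫⁻ z in Ω, ENNReal.ofReal (jacobian Ω f z) ≤ ENNReal.ofReal L := by
    refine lintegral_weakJacobian_le hf'c (fun z hz => ?_) ?_ hmx hmy hHx hHy
    · rw [← hff'Ω hz]; exact hf_maps (hsub hz)
    · exact (hf_inj.mono hsub).congr hff'Ω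
  have hpm : Measurable fun z : ℂ => deriv u z.re := (measurable_deriv u).comp Complex.measurable_re
  have hQint : ∫⁻ z in Ω, Q z ≤ ENNReal.ofReal (|α| * (L + L₀)) := by
    calc ∫⁻ z in Ω, Q z ≤ ∫⁻ z in Ω, ENNReal.ofReal |α| *
          (ENNReal.ofReal (jacobian Ω f z) + ENNReal.ofReal (deriv u z.re)) := by
          refine lintegral_mono fun z => ?_
          simp only [hQ]
          rw [ENNReal.ofReal_mul hαpos.le]
          gcongr
          exact ENNReal.ofReal_add_le
      _ = ENNReal.ofReal |α| * ((∫⁻ z in Ω, ENNReal.ofReal (jacobian Ω f z))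
          + ENNReal.ofReal L₀) := by
          rw [lintegral_const_mul' _ _ ENNReal.ofReal_ne_top,
            lintegral_add_right _ hpm.ennreal_ofReal, hpint]
      _ ≤ ENNReal.ofReal |α| * (ENNReal.ofReal L + ENNReal.ofReal L₀) := by gcongr
      _ = _ := by rw [← ENNReal.ofReal_add hL.le hL₀0, ← ENNReal.ofReal_mul hαpos.le]
  have hxm := hmx.aemeasurable
  have hym := hmy.aemeasurable
  have hJm : AEMeasurable (jacobian Ω f) (volume.restrict Ω) :=
    ((Complex.measurable_re.comp_aemeasurable hxm).mul
      (Complex.measurable_im.comp_aemeasurable hym)).sub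
      ((Complex.measurable_im.comp_aemeasurable hxm).mul
        (Complex.measurable_re.comp_aemeasurable hym))
  have hQm : AEMeasurable Q (volume.restrict Ω) :=
    ((hJm.add hpm.aemeasurable).const_mul |α|).ennreal_ofReal
  have hTm : AEMeasurable T (volume.restrict Ω) :=
    ((aemeasurable_comp_distortion hφ_mono (aemeasurable_distortion hxm hym)).mul
      (hw_meas.comp_quasiMeasurePreserving hre)).ennreal_ofReal
  have hle : (∫⁻ z in Ω, S z) + ∫⁻ z in Ω, R z ≤ ∫⁻ z in Ω, (S z + R z) := le_lintegral_add _ _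
  have hle' : ∫⁻ z in Ω, (S z + R z) ≤ ∫⁻ z in Ω, (T z + Q z) :=
    lintegral_mono_ae (hpt.mono fun z hz => hz.1)
  have hadd : ∫⁻ z in Ω, (T z + Q z) = (∫⁻ z in Ω, T z) + ∫⁻ z in Ω, Q z :=
    lintegral_add_right' _ hQm
  have hmain : (∫⁻ z in Ω, S z) + ENNReal.ofReal (2 * |α| * L)
      ≤ (∫⁻ z in Ω, T z) + ENNReal.ofReal (|α| * (L + L₀)) := by
    calc _ ≤ (∫⁻ z in Ω, S z) + ∫⁻ z in Ω, R z := by gcongr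
      _ ≤ _ := hle.trans hle'
      _ ≤ _ := by rw [hadd]; gcongr
  have hCD : |α| * (L + L₀) ≤ 2 * |α| * L := by nlinarith
  rw [hE₀, hE]
  have hineq : ∫⁻ z in Ω, S z ≤ ∫⁻ z in Ω, T z := by
    refine (ENNReal.add_le_add_iff_right
      (ENNReal.ofReal_ne_top (r := |α| * (L + L₀)))).1 (le_trans ?_ hmain)
    gcongr
  have hstrict : ∫⁻ z in Ω, S z < ⊤ → L₀ < L → ∫⁻ z in Ω, S z < ∫⁻ z in Ω, T z := by
    intro hfin hlt
    refine (ENNReal.add_lt_add_iff_right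
      (ENNReal.ofReal_ne_top (r := |α| * (L + L₀)))).1 (lt_of_lt_of_le ?_ hmain)
    refine ENNReal.add_lt_add_left hfin.ne ((ENNReal.ofReal_lt_ofReal_iff (by positivity)).2 ?_)
    nlinarith
  refine ⟨hineq, fun hfin => ⟨⟨fun heq => ?_, fun heq => ?_⟩, hstrict hfin⟩⟩
  · have hLL : L₀ = L := by
      by_contra hne
      exact (hstrict hfin (lt_of_le_of_ne hL₀ hne)).ne heq.symm
    -- All inequalities are equalities, so the differential of `f` is that of the stretch map.
    have hTQfin : ∫⁻ z in Ω, (T z + Q z) ≠ ⊤ := by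
      rw [hadd, heq]
      exact ENNReal.add_ne_top.2 ⟨hfin.ne, ne_top_of_le_ne_top ENNReal.ofReal_ne_top hQint⟩
    have hge : ∫⁻ z in Ω, (T z + Q z) ≤ ∫⁻ z in Ω, (S z + R z) := by
      rw [hadd, heq]
      refine le_trans ?_ hle
      exact add_le_add le_rfl (hQint.trans ((ENNReal.ofReal_le_ofReal hCD).trans hRint))
    have hae := ae_eq_of_ae_le_of_lintegral_le (hpt.mono fun z hz => hz.1)
      (ne_top_of_le_ne_top hTQfin hle') (hTm.add hQm) hge
    have hD : ∀ᵐ z ∂volume.restrict Ω, gx z = (deriv u z.re : ℝ) ∧ gy z = Complex.I := by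
      filter_upwards [hpt, hae] with z hz hz' using hz.2 hz'
    intro z hz
    rw [hff' hz]
    apply Complex.ext
    · have := hHx.eq_of_ae_eq_deriv hℓ one_pos Complex.reCLM hu ?_ ?_ hz.1 hz.2
      · simpa only [coordXY_apply, Complex.reCLM_apply, Complex.eta, stretchMap] using this
      · filter_upwards [ae_ae_of_ae_restrict measurePreserving_coordXY (coordXY_preimage ℓ) hD]
          with y hy
        filter_upwards [hy] with x hx
        rw [hx.1, coordXY_apply, Complex.reCLM_apply, Complex.ofReal_re]
      · intro y hy
        rw [Complex.reCLM_apply, hbx0 y hy, hu_zero]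
    · have := hHy.eq_of_ae_eq_deriv one_pos hℓ Complex.imCLM (v := id)
        contDiff_id.contDiffOn.absolutelyContinuousOnInterval ?_ ?_ hz.2 hz.1
      · simpa only [coordYX_apply, Complex.imCLM_apply, Complex.eta, stretchMap, id] using this
      · filter_upwards [ae_ae_of_ae_restrict measurePreserving_coordYX (coordYX_preimage ℓ) hD]
          with y hy
        filter_upwards [hy] with x hx
        rw [hx.2, Complex.imCLM_apply, Complex.I_im, deriv_id]
      · intro y hy
        rw [Complex.imCLM_apply, hby0 y hy, id]
  · rw [← hE, ← hE₀]
    have h1 : ∀ v, weakPartial Ω v f = weakPartial Ω v (stretchMap u) := fun v =>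
      weakPartial_congr hΩo.measurableSet (heq.mono hsub)
    have h2 : distortion Ω f = distortion Ω (stretchMap u) := by
      funext z
      have e1 : jacobian Ω f z = jacobian Ω (stretchMap u) z := by simp only [jacobian, h1]
      have e2 : normSqDeriv Ω f z = normSqDeriv Ω (stretchMap u) z := by
        simp only [normSqDeriv, h1]
      rw [distortion, distortion, e1, e2]
    simp only [distortionEnergy, ← hΩ, h2]
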